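/- Let $d\ge 3$ and let $V:\mathbb R^d\to[0,\infty)$ be locally integrable, not almost everywhere zero, and in the reverse Hölder class $RH_s(\mathbb R^d)$ for some $s\in[d/2,\infty]$; that is, for some constant $K>0$, $$\Big(\frac1{|B|}\int_B V^s\Big)^{1/s}\le \frac{K}{|B|}\int_B V\qquad\text{for every ball } B$$ (with the essential supremum over $B$ on the left when $s=\infty$). Let $$\rho(x)=\sup\Big\{r>0:\ r^{2-d}\int_{B(x,r)}V(y)\,dy\le 1\Big\}$$ be the critical radius function of $V$. Call a pair $(C_0,N_0)$ with $C_0\ge1$, $N_0>0$ *admissible* if Shen's comparison estimate $$\frac1{C_0}\Big(1+\frac{|x-y|}{\rho(x)}\Big)^{-N_0}\le\frac{\rho(y)}{\rho(x)}\le C_0\Big(1+\frac{|x-y|}{\rho(x)}\Big)^{\frac{N_0}{N_0+1}}$$ holds for all $x,y\in\mathbb R^d$, where $|\cdot|$ is the Euclidean norm. Let $Q(x_0,r)$ be the cube with centre $x_0$, side length $r$ and sides parallel to the axes. For $0<\theta<\infty$, a real-valued $f\in L^1_{\rm loc}(\mathbb R^d)$ belongs to $\mathrm{BLO}_{\rho,\theta}(\mathbb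 R^d)$ if $$\|f\|_{\mathrm{BLO}_{\rho,\theta}}:=\sup_{x_0\in\mathbb R^d,\ r>0}\Big(1+\frac r{\rho(x_0)}\Big)^{-\theta}\frac1{|Q|}\int_{Q}\Big[f(x)-\operatorname*{ess\,inf}_{Q}f\Big]dx<\infty,\qquad Q=Q(x_0,r).$$ **John–Nirenberg inequality for $\mathrm{BLO}_{\rho,\theta}$.** Admissible pairs exist. Moreover, let $(C,N_0)$ be any admissible pair and let $C_0\ge C\cdot\max\{1,\sqrt d/2\}^{N_0}$ (for $d\le4$ this includes $C_0=C$). Then $(C_0,N_0)$ is admissible, and for every $0<\theta<\infty$, every $f\in\mathrm{BLO}_{\rho,\theta}(\mathbb R^d)$, every cube $Q=Q(x_0,r)$ and every $\lambda>0$, $$\Big|\Big\{x\in Q:\ f(x)-\operatorname*{ess\,inf}_{Q}f>\lambda\Big\}\Big|\le e\,|Q|\exp\Big\{-\Big(1+\frac r{\rho(x_0)}\Big)^{-(N_0+1)\theta}\frac{\overline C_2\,\lambda}{\|f\|_{\mathrm{BLO}_{\rho,\theta}}}\Big\},\qquad \overline C_2=\frac1{C_0^{\theta}\,2^d\,e},$$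 where the right-hand side is read as $0$ if $\|f\|_{\mathrm{BLO}_{\rho,\theta}}=0$. -/

import Mathlib

open MeasureTheory
open scoped ENNReal

noncomputable section

/-- `V` is a nonnegative locally integrable function in the reverse Hölder class `RH_s(ℝ^d)`:
`(⨍_B V^s)^(1/s) ≤ K ⨍_B V` for all balls `B`. The left side is the `L^s` norm with respect to
normalized Lebesgue measure on `B` (the essential supremum when `s = ∞`). -/
structure ReverseHolder {d : ℕ} (s : ℝ≥0∞) (V : EuclideanSpace ℝ (Fin d) → ℝ) : Prop where
  nonneg : ∀ x, 0 ≤ V x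
  locallyIntegrable : LocallyIntegrable V volume
  reverse_holder : ∃ K : ℝ, 0 < K ∧ ∀ (x : EuclideanSpace ℝ (Fin d)) (r : ℝ), 0 < r →
    eLpNorm V s ((volume (Metric.ball x r))⁻¹ • volume.restrict (Metric.ball x r))
      ≤ ENNReal.ofReal (K * ⨍ y in Metric.ball x r, V y)

/-- The critical radius function
`ρ(x) = sup {r > 0 : r^{-(d-2)} ∫_{B(x,r)} V ≤ 1}` (used for `d ≥ 3`). -/
def criticalRadius {d : ℕ} (V : EuclideanSpace ℝ (Fin d) → ℝ)
    (x : EuclideanSpace ℝ (Fin d)) : ℝ :=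
  sSup {r : ℝ | 0 < r ∧ 1 / r ^ (d - 2) * ∫ y in Metric.ball x r, V y ≤ 1}

/-- `C₀ ≥ 1` and `N₀ > 0` are admissible constants in Shen's comparison estimate for `ρ`. -/
structure ShenComparison {d : ℕ} (ρ : EuclideanSpace ℝ (Fin d) → ℝ) (C₀ N₀ : ℝ) : Prop where
  one_le : 1 ≤ C₀
  pos : 0 < N₀
  lower : ∀ x y, 1 / C₀ * (1 + ‖x - y‖ / ρ x) ^ (-N₀) ≤ ρ y / ρ x
  upper : ∀ x y, ρ y / ρ x ≤ C₀ * (1 + ‖x - y‖ / ρ x) ^ (N₀ / (N₀ + 1))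

/-- The cube `Q(x₀, r)` centered at `x₀` with side length `r`, sides parallel to the axes. -/
def cube {d : ℕ} (x₀ : EuclideanSpace ℝ (Fin d)) (r : ℝ) : Set (EuclideanSpace ℝ (Fin d)) :=
  {x | ∀ i, |x i - x₀ i| ≤ r / 2}

/-- The essential infimum of `f` over `E`, as an extended real number: it is `⊥` exactly when `f`
is not essentially bounded below on `E`. -/
def essInfOn {d : ℕ} (f : EuclideanSpace ℝ (Fin d) → ℝ) (E : Set (EuclideanSpace ℝ (Fin d))) :
    EReal :=
  essInf (fun y => (f y : EReal)) (volume.restrict E)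

/-- The `BLO_{ρ,θ}` constant of `f`, with values in `[0, ∞]`:
`sup_Q (1 + r/ρ(x₀))^{-θ} |Q|⁻¹ ∫_Q (f - ess inf_Q f)`, over all cubes `Q = Q(x₀, r)`. -/
def bloNorm {d : ℕ} (ρ : EuclideanSpace ℝ (Fin d) → ℝ) (θ : ℝ)
    (f : EuclideanSpace ℝ (Fin d) → ℝ) : ℝ≥0∞ :=
  ⨆ (x₀ : EuclideanSpace ℝ (Fin d)) (r : ℝ) (_ : 0 < r),
    ENNReal.ofReal ((1 + r / ρ x₀) ^ (-θ)) *
      ((volume (cube x₀ r))⁻¹ *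
        ∫⁻ x in cube x₀ r, ((f x : EReal) - essInfOn f (cube x₀ r)).toENNReal)

/-- `f ∈ BLO_{ρ,θ}(ℝ^d)`. -/
structure MemBLO {d : ℕ} (ρ : EuclideanSpace ℝ (Fin d) → ℝ) (θ : ℝ)
    (f : EuclideanSpace ℝ (Fin d) → ℝ) : Prop where
  locallyIntegrable : LocallyIntegrable f volume
  bloNorm_lt_top : bloNorm ρ θ f < ∞

end

/-! Existence of admissible pairs. Let `w = V^(d/2) dx`. At the exponent `d/2` the powers of `r`
cancel, so the reverse Hölder inequality and Hölder's inequality together make `r^(2-d) ∫_B V`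
comparable to `w(B)^(2/d)`. Hence `ρ(x)` is, up to constants, the radius at which `w(B(x, ρ(x)))`
has size 1. The measure `w` is doubling because `V` cannot concentrate in thin annuli, and therefore
also reverse doubling. Power bounds on the growth of `w` then compare the radii at two points
(`exists_shenComparison_of_doubling`).

John–Nirenberg. On subcubes of `Q(x₀, r)` the comparison estimate bounds the weight `1 + s/ρ(x)` by
`C₀ (1 + r/ρ(x₀))^(N₀+1)`, so there `f` has ordinary bounded lower oscillation with `A = C₀^θ (1 +
r/ρ(x₀))^((N₀+1)θ) ‖f‖`. Stop dyadically at the cubes where the average of `f - ess inf_Q f` exceeds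
`eA`. They occupy at most `|Q|/e`, and the essential infimum on each exceeds that on `Q` by at most
`2^d e A`, since its parent was not stopped. Iteration gains a factor `1/e` for each `2^d e A` of
height (`volume_superlevel_le_exp_neg`). -/

/-! ### Growth under doubling, and Shen's comparison for an abstract mass function -/

/-- Iterated doubling gives polynomial growth. -/
theorem growth_of_doubling {g : ℝ → ℝ} {n : ℕ} (hmono : ∀ r s, 0 < r → r ≤ s → g r ≤ g s)
    (hdbl : ∀ r, 0 < r → g (2 * r) ≤ 2 ^ n * g r) (hpos : ∀ r, 0 < r → 0 < g r)
    {r l : ℝ} (hr : 0 < r) (hl : 1 ≤ l) : g (l * r) ≤ 2 ^ n * l ^ n * g r := by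
  have iter : ∀ k : ℕ, g (2 ^ k * r) ≤ (2 ^ n) ^ k * g r := by
    intro k
    induction k with
    | zero => simp
    | succ k ih =>
      calc g (2 ^ (k + 1) * r) = g (2 * (2 ^ k * r)) := by ring_nf
        _ ≤ 2 ^ n * g (2 ^ k * r) := hdbl _ (by positivity)
        _ ≤ 2 ^ n * ((2 ^ n) ^ k * g r) := by gcongr
        _ = _ := by ring
  obtain ⟨k, hk, hk'⟩ := exists_nat_pow_near hl (one_lt_two : (1 : ℝ) < 2)
  have hg := hpos r hr
  calc g (l * r) ≤ g (2 ^ (k + 1) * r) := hmono _ _ (by positivity) (by gcongr)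
    _ ≤ (2 ^ n) ^ (k + 1) * g r := iter _
    _ = 2 ^ n * (2 ^ k) ^ n * g r := by rw [← pow_mul, ← pow_mul, ← pow_add]; ring_nf
    _ ≤ 2 ^ n * l ^ n * g r := by gcongr

/-- Iterated reverse doubling gives a positive power of growth from below. -/
theorem growth_of_reverse_doubling {g : ℝ → ℝ} {δ : ℝ} (hδ : 0 < δ)
    (hmono : ∀ r s, 0 < r → r ≤ s → g r ≤ g s)
    (hdbl : ∀ r, 0 < r → 4 ^ δ * g r ≤ g (4 * r)) (hpos : ∀ r, 0 < r → 0 < g r)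
    {r l : ℝ} (hr : 0 < r) (hl : 1 ≤ l) : (l / 4) ^ δ * g r ≤ g (l * r) := by
  have iter : ∀ k : ℕ, ((4 : ℝ) ^ k) ^ δ * g r ≤ g (4 ^ k * r) := by
    intro k
    induction k with
    | zero => simp
    | succ k ih =>
      calc ((4 : ℝ) ^ (k + 1)) ^ δ * g r = 4 ^ δ * (((4 : ℝ) ^ k) ^ δ * g r) := by
            rw [pow_succ, Real.mul_rpow (by positivity) (by positivity)]; ring
        _ ≤ 4 ^ δ * g (4 ^ k * r) := by gcongr
        _ ≤ g (4 * (4 ^ k * r)) := hdbl _ (by positivity)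
        _ = _ := by ring_nf
  obtain ⟨k, hk, hk'⟩ := exists_nat_pow_near hl (by norm_num : (1 : ℝ) < 4)
  have hg := hpos r hr
  calc (l / 4) ^ δ * g r ≤ ((4 : ℝ) ^ k) ^ δ * g r := by
        gcongr
        rw [div_le_iff₀ (by norm_num)]
        exact hk'.le.trans_eq (pow_succ _ _)
    _ ≤ g (4 ^ k * r) := iter k
    _ ≤ g (l * r) := hmono _ _ (by positivity) (by gcongr)

/-- The lower comparison estimate, applied with the two points exchanged, yields the upper one. -/
theorem ShenComparison.of_lower {d : ℕ} {ρ : EuclideanSpace ℝ (Fin d) → ℝ} {C N : ℝ}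
    (hρ : ∀ x, 0 < ρ x) (hC : 1 ≤ C) (hN : 0 < N)
    (h : ∀ x y, 1 / C * (1 + ‖x - y‖ / ρ x) ^ (-N) ≤ ρ y / ρ x) :
    ShenComparison ρ (C * 2 ^ N) N := by
  have h2 : (1 : ℝ) ≤ 2 ^ N := Real.one_le_rpow (by norm_num) hN.le
  have hC2 : C ≤ C * 2 ^ N := le_mul_of_one_le_right (by linarith) h2
  refine ⟨hC.trans hC2, hN, fun x y => le_trans ?_ (h x y), fun x y => ?_⟩
  · have := hρ x
    gcongr
  have hx := hρ x
  have hy := hρ y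
  set u := ρ y / ρ x with hu
  set t := ‖x - y‖ / ρ x with ht
  have hu0 : 0 < u := div_pos hy hx
  have ht0 : 0 ≤ t := by positivity
  have hM : 0 < N / (N + 1) := by positivity
  have h1 : (1 : ℝ) ≤ (1 + t) ^ (N / (N + 1)) := Real.one_le_rpow (by linarith) hM.le
  have key : u ≤ C * (1 + t / u) ^ N := by
    have h3 := h y x
    have e1 : ‖y - x‖ / ρ y = t / u := by
      rw [norm_sub_rev, ht, hu]; field_simp
    have e2 : ρ x / ρ y = 1 / u := by rw [hu]; field_simp
    rw [e1, e2, Real.rpow_neg (by positivity)] at h3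
    have h4 : 0 < (1 + t / u) ^ N := by positivity
    rw [← one_div, div_mul_div_comm, one_mul, one_div_le_one_div (by positivity) hu0] at h3
    exact h3
  -- For `t ≤ u`, `key` bounds `u` by a constant. For `t > u`, `(1 + t/u) u ≤ 2t` turns `key` into
  -- `u^(N+1) ≤ C 2^N t^N`, whose root gives the exponent `N/(N+1)`.
  rcases le_or_gt t u with htu | htu
  · calc u ≤ C * (1 + t / u) ^ N := key
      _ ≤ C * 2 ^ N := by
        gcongr
        have : t / u ≤ 1 := (div_le_one hu0).2 htu
        linarith
      _ ≤ _ := le_mul_of_one_le_right (by positivity) h1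
  · have h5 : u ^ (N + 1) ≤ (C * 2 ^ N) * t ^ N := by
      have : (1 + t / u) ^ N * u ^ N ≤ (2 * t) ^ N := by
        rw [← Real.mul_rpow (by positivity) hu0.le]
        refine Real.rpow_le_rpow (by positivity) ?_ hN.le
        calc (1 + t / u) * u = u + t := by field_simp
          _ ≤ 2 * t := by linarith
      calc u ^ (N + 1) = u * u ^ N := by rw [Real.rpow_add hu0, Real.rpow_one, mul_comm]
        _ ≤ C * (1 + t / u) ^ N * u ^ N := by gcongr
        _ = C * ((1 + t / u) ^ N * u ^ N) := by ring
        _ ≤ C * (2 * t) ^ N := by gcongr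
        _ = _ := by rw [Real.mul_rpow (by norm_num) ht0]; ring
    have h6 : u ≤ ((C * 2 ^ N) * t ^ N) ^ (1 / (N + 1)) := by
      rw [← Real.rpow_le_rpow_iff hu0.le (by positivity) (by positivity : (0 : ℝ) < N + 1),
        ← Real.rpow_mul (by positivity), one_div_mul_cancel (by positivity), Real.rpow_one]
      exact h5
    refine h6.trans ?_
    rw [Real.mul_rpow (by positivity) (by positivity), ← Real.rpow_mul ht0, mul_one_div]
    gcongr
    · refine (Real.rpow_le_rpow_of_exponent_le (hC.trans hC2) ?_).trans_eq (Real.rpow_one _)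
      rw [div_le_one (by positivity)]; linarith
    · linarith

/-- Shen's comparison estimate for a function `ρ` such that `F x (ρ x)` is bounded above and below,
where `F x r` behaves like the mass of `B(x, r)` for a doubling and reverse doubling measure. -/
theorem exists_shenComparison_of_doubling {d : ℕ} {ρ : EuclideanSpace ℝ (Fin d) → ℝ}
    {F : EuclideanSpace ℝ (Fin d) → ℝ → ℝ} {n : ℕ} {δ b B : ℝ}
    (hmono : ∀ x y r s, 0 < r → r + ‖x - y‖ ≤ s → F x r ≤ F y s)
    (hdbl : ∀ x r, 0 < r → F x (2 * r) ≤ 2 ^ n * F x r) (hδ : 0 < δ)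
    (hrev : ∀ x r, 0 < r → 4 ^ δ * F x r ≤ F x (4 * r))
    (hpos : ∀ x r, 0 < r → 0 < F x r) (hρ : ∀ x, 0 < ρ x) (hb : 0 < b)
    (hbF : ∀ x, b ≤ F x (ρ x)) (hFB : ∀ x, F x (ρ x) ≤ B) :
    ∃ C N : ℝ, ShenComparison ρ C N := by
  have hm : ∀ x r s, 0 < r → r ≤ s → F x r ≤ F x s := fun x r s hr hrs =>
    hmono x x r s hr (by simpa using hrs)
  have hB : 0 < B := (hpos 0 _ (hρ 0)).trans_le (hFB 0)
  -- One `2^n` comes from `growth_of_doubling`, the other from its argument `2(1+t)`. The 4 in `C`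
  -- undoes the `l/4` of reverse doubling, and `n + 1` in place of `n` keeps `N` positive when `n =
  -- 0`.
  set C₁ : ℝ := 2 ^ n * 2 ^ n * B / b with hC₁
  have hC₁0 : 0 < C₁ := by positivity
  set C : ℝ := max 1 (4 * C₁ ^ (1 / δ)) with hC
  set N : ℝ := (n + 1) / δ with hN
  have hN0 : 0 < N := by positivity
  have hC1 : 1 ≤ C := le_max_left _ _
  refine ⟨C * 2 ^ N, N, ShenComparison.of_lower hρ hC1 hN0 fun x y => ?_⟩
  have hx := hρ x
  have hy := hρ y
  set t := ‖x - y‖ / ρ x with ht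
  have ht0 : 0 ≤ t := by positivity
  have hN1 : 1 ≤ (1 + t) ^ N := Real.one_le_rpow (by linarith) hN0.le
  set R := ρ x * (1 + t) with hR
  have hRx : R = ρ x + ‖x - y‖ := by rw [hR, ht]; field_simp
  have hR0 : 0 < R := by positivity
  rw [Real.rpow_neg (by positivity), ← one_div, div_mul_div_comm, one_mul,
    div_le_div_iff₀ (by positivity) hx, one_mul]
  -- Only `ρ y < R` matters: the mass at `y` grows from at least `b` at radius `ρ y` to radius `R`,
  -- while `B(y, R)` lies in `B(x, 2R)`, whose mass is at most polynomial in `1 + t`.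
  rcases le_or_gt R (ρ y) with hRy | hRy
  · calc ρ x ≤ R := by rw [hRx]; linarith [norm_nonneg (x - y)]
      _ ≤ ρ y := hRy
      _ ≤ _ := le_mul_of_one_le_right hy.le (one_le_mul_of_one_le_of_one_le hC1 hN1)
  have h1 : (R / ρ y / 4) ^ δ * F y (ρ y) ≤ F y R := by
    have := growth_of_reverse_doubling hδ (hm y) (hrev y) (hpos y) hy
      ((one_le_div hy).2 hRy.le)
    rwa [div_mul_cancel₀ _ hy.ne'] at this
  have h2 : F y R ≤ F x (2 * (1 + t) * ρ x) := by
    refine hmono y x _ _ hR0 ?_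
    rw [norm_sub_rev]
    have : 2 * (1 + t) * ρ x = R + R := by rw [hR]; ring
    rw [this]
    linarith
  have h3 := growth_of_doubling (hm x) (hdbl x) (hpos x) hx (l := 2 * (1 + t)) (by linarith)
  have h4 : (R / ρ y / 4) ^ δ ≤ C₁ * (1 + t) ^ ((n : ℝ) + 1) := by
    have h5 : (R / ρ y / 4) ^ δ * b ≤ 2 ^ n * (2 * (1 + t)) ^ n * B := by
      calc (R / ρ y / 4) ^ δ * b ≤ (R / ρ y / 4) ^ δ * F y (ρ y) := by
            gcongr; exact hbF y
        _ ≤ _ := h1.trans (h2.trans h3)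
        _ ≤ _ := by gcongr; exact hFB x
    rw [← le_div_iff₀ hb] at h5
    refine h5.trans ?_
    rw [mul_pow, hC₁]
    have : (1 + t) ^ n ≤ (1 + t) ^ ((n : ℝ) + 1) := by
      rw [← Real.rpow_natCast]
      exact Real.rpow_le_rpow_of_exponent_le (by linarith) (by linarith)
    calc 2 ^ n * (2 ^ n * (1 + t) ^ n) * B / b = 2 ^ n * 2 ^ n * B / b * (1 + t) ^ n := by ring
      _ ≤ _ := by gcongr
  have h6 : R / ρ y / 4 ≤ C₁ ^ (1 / δ) * (1 + t) ^ N := by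
    rw [← Real.rpow_le_rpow_iff (by positivity) (by positivity) hδ,
      Real.mul_rpow (by positivity) (by positivity), ← Real.rpow_mul (by positivity),
      ← Real.rpow_mul (by positivity), one_div_mul_cancel hδ.ne', Real.rpow_one, hN,
      div_mul_cancel₀ _ hδ.ne']
    exact h4
  calc ρ x ≤ R := by rw [hRx]; linarith [norm_nonneg (x - y)]
    _ = ρ y * (4 * (R / ρ y / 4)) := by field_simp
    _ ≤ ρ y * (4 * (C₁ ^ (1 / δ) * (1 + t) ^ N)) := by gcongr
    _ = ρ y * (4 * C₁ ^ (1 / δ) * (1 + t) ^ N) := by ring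
    _ ≤ ρ y * (C * (1 + t) ^ N) := by gcongr; exact le_max_right _ _

/-! ### Reverse Hölder weights and the scaled mass -/

/-- Normalized measure on a ball is a probability measure, so `L^q` norms increase with `q`. This
reduces every `s ≥ d/2` to the endpoint `d/2`. -/
theorem ReverseHolder.mono_exponent {d : ℕ} {s q : ℝ≥0∞} (hqs : q ≤ s)
    {V : EuclideanSpace ℝ (Fin d) → ℝ} (hV : ReverseHolder s V) : ReverseHolder q V := by
  obtain ⟨K, hK, h⟩ := hV.reverse_holder
  refine ⟨hV.nonneg, hV.locallyIntegrable, K, hK, fun x r hr => ?_⟩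
  refine le_trans ?_ (h x r hr)
  have h0 : volume (Metric.ball x r) ≠ 0 := (Metric.measure_ball_pos volume x hr).ne'
  have : IsProbabilityMeasure
      ((volume (Metric.ball x r))⁻¹ • volume.restrict (Metric.ball x r)) := by
    constructor
    rw [Measure.smul_apply, Measure.restrict_apply_univ, smul_eq_mul,
      ENNReal.inv_mul_cancel h0 measure_ball_lt_top.ne]
  exact eLpNorm_le_eLpNorm_of_exponent_le hqs
    (hV.locallyIntegrable.aestronglyMeasurable.restrict.smul_measure _)

theorem integrableOn_ball_of_locallyIntegrable {d : ℕ} {V : EuclideanSpace ℝ (Fin d) → ℝ}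
    (hV : LocallyIntegrable V volume) (x : EuclideanSpace ℝ (Fin d)) (r : ℝ) :
    IntegrableOn V (Metric.ball x r) volume :=
  (hV.integrableOn_isCompact (isCompact_closedBall x r)).mono_set Metric.ball_subset_closedBall

theorem volume_real_ball {d : ℕ} (hd : 0 < d) (x : EuclideanSpace ℝ (Fin d)) {r : ℝ} (hr : 0 ≤ r) :
    volume.real (Metric.ball x r) =
      r ^ d * volume.real (Metric.ball (0 : EuclideanSpace ℝ (Fin d)) 1) := by
  have : Nonempty (Fin d) := ⟨⟨0, hd⟩⟩
  rw [measureReal_def, Measure.addHaar_ball _ _ hr, finrank_euclideanSpace_fin, ENNReal.toReal_mul,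
    ENNReal.toReal_ofReal (by positivity), measureReal_def]

/-- Hölder's inequality for the integral of a nonnegative function over a set. -/
theorem setIntegral_le_eLpNorm_mul_rpow {α : Type*} [MeasurableSpace α] {μ : Measure α} {V : α → ℝ}
    {q : ℝ≥0∞} (hq : 1 ≤ q) {S : Set α} (h0 : ∀ x, 0 ≤ V x) (hV : IntegrableOn V S μ)
    (hS : μ S ≠ ∞) (hM : eLpNorm V q (μ.restrict S) ≠ ∞) :
    ∫ y in S, V y ∂μ ≤ (eLpNorm V q (μ.restrict S)).toReal * μ.real S ^ (1 - 1 / q.toReal) := by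
  have hexp : 0 ≤ 1 - 1 / q.toReal := by
    rcases eq_or_ne q ∞ with rfl | hq'
    · simp
    have : 1 ≤ q.toReal := by
      simpa using ENNReal.toReal_mono hq' hq
    rw [sub_nonneg, div_le_one (by linarith)]
    exact this
  have h := eLpNorm_le_eLpNorm_mul_rpow_measure_univ hq hV.aestronglyMeasurable
  rw [eLpNorm_one_eq_lintegral_enorm, Measure.restrict_apply_univ, ENNReal.toReal_one,
    div_one] at h
  rw [integral_eq_lintegral_of_nonneg_ae (Filter.Eventually.of_forall h0) hV.aestronglyMeasurable,
    measureReal_def, ENNReal.toReal_rpow, ← ENNReal.toReal_mul]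
  refine ENNReal.toReal_mono
    (ENNReal.mul_ne_top hM (ENNReal.rpow_ne_top_of_nonneg hexp hS)) (le_trans (le_of_eq ?_) h)
  refine lintegral_congr fun x => ?_
  rw [Real.enorm_of_nonneg (h0 x)]

/-- The scaled mass `r^{2-d} ∫_{B(x,r)} V`. -/
noncomputable def scaledMass {d : ℕ} (V : EuclideanSpace ℝ (Fin d) → ℝ)
    (x : EuclideanSpace ℝ (Fin d)) (r : ℝ) : ℝ :=
  1 / r ^ (d - 2) * ∫ y in Metric.ball x r, V y

theorem toReal_natCast_div_two (d : ℕ) : ((d : ℝ≥0∞) / 2).toReal = (d : ℝ) / 2 := by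
  simp

theorem one_le_natCast_div_two {d : ℕ} (hd : 3 ≤ d) : (1 : ℝ≥0∞) ≤ (d : ℝ≥0∞) / 2 := by
  rw [ENNReal.le_div_iff_mul_le (by simp) (by simp), one_mul]
  exact_mod_cast (by omega : 2 ≤ d)

theorem pow_rpow_one_sub {d : ℕ} (hd : 3 ≤ d) {r : ℝ} (hr : 0 ≤ r) :
    (r ^ d) ^ (1 - 1 / ((d : ℝ) / 2)) = r ^ (d - 2) := by
  have hd0 : (d : ℝ) ≠ 0 := by positivity
  rw [← Real.rpow_natCast, ← Real.rpow_mul hr, ← Real.rpow_natCast]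
  congr 1
  rw [Nat.cast_sub (by omega)]
  field_simp
  norm_num

/-- Removing the normalization multiplies the average by `|B|^(2/d)`, of order `r²`; against `|B|⁻¹`
this leaves exactly the factor `r^(2-d)`. -/
theorem ReverseHolder.eLpNorm_le_scaledMass {d : ℕ} (hd : 3 ≤ d)
    {V : EuclideanSpace ℝ (Fin d) → ℝ} (hV : ReverseHolder ((d : ℝ≥0∞) / 2) V) :
    ∃ K : ℝ, 0 < K ∧ ∀ x r, 0 < r →
      eLpNorm V ((d : ℝ≥0∞) / 2) (volume.restrict (Metric.ball x r)) ≤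
        ENNReal.ofReal (K * scaledMass V x r) := by
  obtain ⟨K, hK, h⟩ := hV.reverse_holder
  set v := volume.real (Metric.ball (0 : EuclideanSpace ℝ (Fin d)) 1) with hv
  have hv0 : 0 < v := ENNReal.toReal_pos (Metric.measure_ball_pos volume _ one_pos).ne'
    measure_ball_lt_top.ne
  refine ⟨K * v⁻¹ * v ^ (1 / ((d : ℝ) / 2)), by positivity, fun x r hr => ?_⟩
  have h1 := h x r hr
  have hB0 : volume (Metric.ball x r) ≠ 0 := (Metric.measure_ball_pos volume x hr).ne'
  have hB : volume (Metric.ball x r) ≠ ∞ := measure_ball_lt_top.ne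
  rw [eLpNorm_smul_measure_of_ne_top (ENNReal.div_ne_top (by simp) (by simp)), smul_eq_mul,
    ENNReal.inv_rpow, mul_comm, ← div_eq_mul_inv, ENNReal.div_le_iff_le_mul
      (Or.inl (by simp [hB0, hB])) (Or.inl (by simp [hB0, hB]))] at h1
  refine h1.trans (le_of_eq ?_)
  rw [← ofReal_measureReal hB, ENNReal.ofReal_rpow_of_pos (by
    rw [volume_real_ball (by omega) x hr.le]; positivity), ← ENNReal.ofReal_mul (by
    refine mul_nonneg hK.le ?_
    exact integral_nonneg hV.nonneg)]
  congr 1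
  rw [setAverage_eq, volume_real_ball (by omega) x hr.le, smul_eq_mul, scaledMass,
    ENNReal.toReal_div, ENNReal.toReal_one, toReal_natCast_div_two,
    Real.mul_rpow (by positivity) (by positivity), ← hv]
  have h2 : (r ^ d) ^ (1 / ((d : ℝ) / 2)) = r ^ 2 := by
    rw [← Real.rpow_natCast, ← Real.rpow_mul hr.le, ← Real.rpow_natCast]
    congr 1
    have hd0 : (d : ℝ) ≠ 0 := by positivity
    field_simp
    norm_num
  rw [h2]
  have h3 : r ^ d = r ^ (d - 2) * r ^ 2 := by rw [← pow_add]; congr 1; omega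
  rw [h3]
  field_simp

section

variable {d : ℕ} {V : EuclideanSpace ℝ (Fin d) → ℝ}

theorem scaledMass_nonneg (h0 : ∀ x, 0 ≤ V x) (x : EuclideanSpace ℝ (Fin d)) {r : ℝ}
    (hr : 0 < r) : 0 ≤ scaledMass V x r :=
  mul_nonneg (by positivity) (integral_nonneg h0)

/-- A reverse Hölder weight does not concentrate on a thin annulus. -/
theorem ReverseHolder.exists_integral_ball_le (hd : 3 ≤ d)
    (hV : ReverseHolder ((d : ℝ≥0∞) / 2) V) :
    ∃ t : ℝ, 0 < t ∧ t < 1 ∧ ∀ x r, 0 < r →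
      ∫ y in Metric.ball x r, V y ≤ 2 * ∫ y in Metric.ball x (t * r), V y := by
  obtain ⟨K, hK, hKM⟩ := hV.eLpNorm_le_scaledMass hd
  set v := volume.real (Metric.ball (0 : EuclideanSpace ℝ (Fin d)) 1) with hv
  have hp : 0 < 1 - 1 / ((d : ℝ) / 2) := by
    have : (3 : ℝ) ≤ d := by exact_mod_cast hd
    rw [sub_pos, div_lt_one (by linarith)]
    linarith
  -- Hölder on the annulus bounds its share of `∫_B V` by this expression. Its exponent `1 - 2/d` is
  -- positive, so a `t` close to 1 makes the share less than one half.
  have hcont : Filter.Tendsto (fun t : ℝ => K * (v * (1 - t ^ d)) ^ (1 - 1 / ((d : ℝ) / 2)))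
      (nhdsWithin 1 (Set.Iio 1)) (nhds 0) := by
    have : ContinuousAt (fun t : ℝ => K * (v * (1 - t ^ d)) ^ (1 - 1 / ((d : ℝ) / 2))) 1 := by
      refine continuousAt_const.mul (ContinuousAt.rpow_const (by fun_prop) (Or.inr hp.le))
    have h := this.tendsto
    simp only [one_pow, sub_self, mul_zero, Real.zero_rpow hp.ne'] at h
    exact h.mono_left nhdsWithin_le_nhds
  obtain ⟨t, ht, ht0, ht1⟩ := ((hcont.eventually (gt_mem_nhds (by norm_num : (0 : ℝ) < 1 / 2))).and
    ((Filter.Eventually.filter_mono nhdsWithin_le_nhds (lt_mem_nhds one_pos)).and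
      self_mem_nhdsWithin)).exists
  refine ⟨t, ht0, ht1, fun x r hr => ?_⟩
  have htr : t * r ≤ r := mul_le_of_le_one_left hr.le (le_of_lt ht1)
  have hsub : Metric.ball x (t * r) ⊆ Metric.ball x r := Metric.ball_subset_ball htr
  have hint := integrableOn_ball_of_locallyIntegrable hV.locallyIntegrable x r
  have hfin : eLpNorm V ((d : ℝ≥0∞) / 2) (volume.restrict (Metric.ball x r)) ≠ ∞ :=
    ne_top_of_le_ne_top ENNReal.ofReal_ne_top (hKM x r hr)
  set A := Metric.ball x r \ Metric.ball x (t * r) with hA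
  have hAsub : A ⊆ Metric.ball x r := Set.sdiff_subset
  have hsplit : ∫ y in A, V y = (∫ y in Metric.ball x r, V y) - ∫ y in Metric.ball x (t * r), V y :=
    setIntegral_sdiff Metric.isOpen_ball.measurableSet hint hsub
  have hmono : eLpNorm V ((d : ℝ≥0∞) / 2) (volume.restrict A) ≤
      eLpNorm V ((d : ℝ≥0∞) / 2) (volume.restrict (Metric.ball x r)) :=
    eLpNorm_mono_measure _ (Measure.restrict_mono hAsub le_rfl)
  have hA' := setIntegral_le_eLpNorm_mul_rpow (one_le_natCast_div_two hd) hV.nonneg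
    (hint.mono_set hAsub) (measure_ne_top_of_subset hAsub measure_ball_lt_top.ne)
    (ne_top_of_le_ne_top hfin hmono)
  have hvA : volume.real A = r ^ d * (v * (1 - t ^ d)) := by
    rw [hA, measureReal_sdiff hsub Metric.isOpen_ball.measurableSet,
      volume_real_ball (by omega) x hr.le,
      volume_real_ball (by omega) x (by positivity : 0 ≤ t * r)]
    ring
  have h1t : 0 ≤ 1 - t ^ d := sub_nonneg.2 (pow_le_one₀ ht0.le (le_of_lt ht1))
  have hm : (eLpNorm V ((d : ℝ≥0∞) / 2) (volume.restrict A)).toReal ≤ K * scaledMass V x r := by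
    refine ENNReal.toReal_le_of_le_ofReal ?_ (hmono.trans (hKM x r hr))
    have := scaledMass_nonneg hV.nonneg x hr
    positivity
  rw [toReal_natCast_div_two, hvA, Real.mul_rpow (by positivity) (by positivity),
    pow_rpow_one_sub hd hr.le] at hA'
  have ha : 0 ≤ ∫ y in Metric.ball x r, V y := integral_nonneg hV.nonneg
  have hfinal : ∫ y in A, V y ≤ 1 / 2 * ∫ y in Metric.ball x r, V y := by
    calc ∫ y in A, V y ≤ K * scaledMass V x r *
          (r ^ (d - 2) * (v * (1 - t ^ d)) ^ (1 - 1 / ((d : ℝ) / 2))) := hA'.trans (by gcongr)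
      _ = K * (v * (1 - t ^ d)) ^ (1 - 1 / ((d : ℝ) / 2)) * ∫ y in Metric.ball x r, V y := by
        rw [scaledMass]; field_simp
      _ ≤ _ := by gcongr
  linarith

/-- Each shrinking of the ball by `t` costs a factor 2 in mass; `m` shrinkings with `t^m < 1/2`
bring radius `2r` below `r`. -/
theorem ReverseHolder.exists_scaledMass_two_mul_le (hd : 3 ≤ d)
    (hV : ReverseHolder ((d : ℝ≥0∞) / 2) V) :
    ∃ D : ℝ, 0 < D ∧ ∀ x r, 0 < r → scaledMass V x (2 * r) ≤ D * scaledMass V x r := by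
  obtain ⟨t, ht0, ht1, h⟩ := hV.exists_integral_ball_le hd
  obtain ⟨m, hm⟩ := exists_pow_lt_of_lt_one (by norm_num : (0 : ℝ) < 1 / 2) ht1
  refine ⟨2 ^ m, by positivity, fun x r hr => ?_⟩
  have iter : ∀ k : ℕ, ∫ y in Metric.ball x (2 * r), V y ≤
      2 ^ k * ∫ y in Metric.ball x (t ^ k * (2 * r)), V y := by
    intro k
    induction k with
    | zero => simp
    | succ k ih =>
      calc _ ≤ _ := ih
        _ ≤ 2 ^ k * (2 * ∫ y in Metric.ball x (t * (t ^ k * (2 * r))), V y) := by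
          gcongr
          exact h x _ (by positivity)
        _ = _ := by rw [← mul_assoc, ← pow_succ, ← mul_assoc, ← pow_succ']
  have hsub : ∫ y in Metric.ball x (t ^ m * (2 * r)), V y ≤ ∫ y in Metric.ball x r, V y := by
    refine setIntegral_mono_set (integrableOn_ball_of_locallyIntegrable hV.locallyIntegrable x r)
      (Filter.Eventually.of_forall hV.nonneg) (LE.le.eventuallyLE
        (Metric.ball_subset_ball ?_))
    nlinarith
  have ha : 0 ≤ ∫ y in Metric.ball x r, V y := integral_nonneg hV.nonneg
  calc scaledMass V x (2 * r) = 1 / (2 * r) ^ (d - 2) * ∫ y in Metric.ball x (2 * r), V y := rfl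
    _ ≤ 1 / r ^ (d - 2) * (2 ^ m * ∫ y in Metric.ball x r, V y) := by
      refine mul_le_mul ?_ ((iter m).trans (by gcongr)) (integral_nonneg hV.nonneg)
        (by positivity)
      gcongr
      linarith
    _ = _ := by rw [scaledMass]; ring

/-- Zero mass on one ball would propagate by doubling to all balls of radius `2^k r`, hence to the
whole space. -/
theorem ReverseHolder.scaledMass_pos (hd : 3 ≤ d) (hV : ReverseHolder ((d : ℝ≥0∞) / 2) V)
    (hV0 : ¬ V =ᵐ[volume] (fun _ => 0)) (x : EuclideanSpace ℝ (Fin d)) {r : ℝ} (hr : 0 < r) :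
    0 < scaledMass V x r := by
  refine (scaledMass_nonneg hV.nonneg x hr).lt_of_ne fun h => hV0 ?_
  obtain ⟨D, hD, hdbl⟩ := hV.exists_scaledMass_two_mul_le hd
  have hz : ∀ k : ℕ, scaledMass V x (2 ^ k * r) = 0 := by
    intro k
    induction k with
    | zero => simpa using h.symm
    | succ k ih =>
      refine le_antisymm ?_ (scaledMass_nonneg hV.nonneg x (by positivity))
      have := hdbl x (2 ^ k * r) (by positivity)
      rwa [ih, mul_zero, ← mul_assoc, ← pow_succ'] at this
  have hae : ∀ k : ℕ, ∀ᵐ y ∂volume.restrict (Metric.ball x (2 ^ k * r)), V y = 0 := by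
    intro k
    have h1 : ∫ y in Metric.ball x (2 ^ k * r), V y = 0 := by
      refine (mul_eq_zero.1 (hz k)).resolve_left ?_
      positivity
    exact (integral_eq_zero_iff_of_nonneg hV.nonneg
      (integrableOn_ball_of_locallyIntegrable hV.locallyIntegrable _ _)).1 h1
  have hU : ⋃ k : ℕ, Metric.ball x (2 ^ k * r) = Set.univ := by
    refine Set.eq_univ_of_forall fun y => Set.mem_iUnion.2 ?_
    obtain ⟨k, hk⟩ := pow_unbounded_of_one_lt (dist y x / r) (one_lt_two : (1 : ℝ) < 2)
    exact ⟨k, Metric.mem_ball.2 ((div_lt_iff₀ hr).1 hk)⟩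
  have := (ae_restrict_iUnion_iff (μ := volume) (fun k : ℕ => Metric.ball x (2 ^ k * r))
    (fun y => V y = 0)).2 hae
  rwa [hU, Measure.restrict_univ] at this

end

/-! ### Reverse doubling and the critical radius -/

/-- A doubling measure on `ℝ^d` is reverse doubling. -/
theorem reverse_doubling_of_doubling {d : ℕ} (hd : 0 < d)
    {w : Measure (EuclideanSpace ℝ (Fin d))} (hfin : ∀ x r, w (Metric.ball x r) ≠ ∞) {D : ℝ}
    (hD : 0 < D)
    (hdbl : ∀ x r, 0 < r → w.real (Metric.ball x (2 * r)) ≤ D * w.real (Metric.ball x r))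
    (x : EuclideanSpace ℝ (Fin d)) {r : ℝ} (hr : 0 < r) :
    (1 + (D * D)⁻¹) * w.real (Metric.ball x r) ≤ w.real (Metric.ball x (4 * r)) := by
  -- `B(x + e, r)` is disjoint from `B(x, r)` and inside `B(x, 4r)`; two doublings make its mass
  -- comparable to that of `B(x, r)`.
  set e : EuclideanSpace ℝ (Fin d) := EuclideanSpace.single ⟨0, hd⟩ (2 * r) with he
  have hen : ‖e‖ = 2 * r := by
    rw [he, PiLp.norm_single, Real.norm_of_nonneg (by positivity)]
  have hxz : dist x (x + e) = 2 * r := by rw [dist_self_add_right, hen]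
  have h1 : w.real (Metric.ball x r) ≤ D * D * w.real (Metric.ball (x + e) r) := by
    calc w.real (Metric.ball x r) ≤ w.real (Metric.ball (x + e) (2 * (2 * r))) :=
          measureReal_mono (Metric.ball_subset_ball' (by rw [hxz]; linarith)) (hfin _ _)
      _ ≤ D * (D * w.real (Metric.ball (x + e) r)) :=
        (hdbl _ _ (by positivity)).trans (by gcongr; exact hdbl _ _ hr)
      _ = _ := by ring
  have h2 : w.real (Metric.ball x r) + w.real (Metric.ball (x + e) r) ≤
      w.real (Metric.ball x (4 * r)) := by
    rw [← measureReal_union (Metric.ball_disjoint_ball (by rw [hxz]; linarith))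
      Metric.isOpen_ball.measurableSet (hfin _ _) (hfin _ _)]
    refine measureReal_mono (Set.union_subset (Metric.ball_subset_ball (by linarith))
      (Metric.ball_subset_ball' ?_)) (hfin _ _)
    rw [dist_comm, hxz]; linarith
  have h3 : (D * D)⁻¹ * w.real (Metric.ball x r) ≤ w.real (Metric.ball (x + e) r) := by
    rw [inv_mul_le_iff₀ (by positivity)]
    exact h1
  linarith

/-- The supremum of the radii `r` with `ψ r ≤ 1`, for `ψ` a power of a function `g` of polynomial
growth and decay. -/
theorem csSup_bounds_of_growth {g ψ : ℝ → ℝ} {n : ℕ} {δ p K₁ K₂ : ℝ} (hδ : 0 < δ) (hp : 0 < p)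
    (hK₁ : 0 < K₁) (hK₂ : 0 < K₂) (hmono : ∀ r s, 0 < r → r ≤ s → g r ≤ g s)
    (hdbl : ∀ r, 0 < r → g (2 * r) ≤ 2 ^ n * g r)
    (hrev : ∀ r, 0 < r → 4 ^ δ * g r ≤ g (4 * r)) (hpos : ∀ r, 0 < r → 0 < g r)
    (h₁ : ∀ r, 0 < r → g r ^ p ≤ K₁ * ψ r) (h₂ : ∀ r, 0 < r → ψ r ≤ K₂ * g r ^ p) :
    0 < sSup {r : ℝ | 0 < r ∧ ψ r ≤ 1} ∧
      (2 ^ n)⁻¹ * (K₂⁻¹) ^ (1 / p) ≤ g (sSup {r : ℝ | 0 < r ∧ ψ r ≤ 1}) ∧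
      g (sSup {r : ℝ | 0 < r ∧ ψ r ≤ 1}) ≤ 2 ^ n * K₁ ^ (1 / p) := by
  have hg1 := hpos 1 one_pos
  have hle : ∀ r, 0 < r → ψ r ≤ 1 → g r ≤ K₁ ^ (1 / p) := by
    intro r hr hψ
    rw [← Real.rpow_le_rpow_iff (hpos r hr).le (by positivity) hp, ← Real.rpow_mul hK₁.le,
      one_div_mul_cancel hp.ne', Real.rpow_one]
    exact (h₁ r hr).trans (mul_le_of_le_one_right hK₁.le hψ)
  have hne : ∃ r, 0 < r ∧ ψ r ≤ 1 := by
    have hlim := (tendsto_rpow_neg_atTop hδ).const_mul (4 ^ δ * g 1)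
    rw [mul_zero] at hlim
    obtain ⟨l, hl, hl1⟩ := ((hlim.eventually (gt_mem_nhds
      (by positivity : 0 < (K₂⁻¹) ^ (1 / p)))).and (Filter.eventually_ge_atTop 1)).exists
    have hl0 : 0 < l := by linarith
    have h := growth_of_reverse_doubling hδ hmono hrev hpos (inv_pos.2 hl0) hl1
    rw [mul_inv_cancel₀ hl0.ne', Real.div_rpow hl0.le (by norm_num), div_mul_eq_mul_div,
      div_le_iff₀ (by positivity)] at h
    refine ⟨l⁻¹, inv_pos.2 hl0, (h₂ _ (inv_pos.2 hl0)).trans ?_⟩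
    have h4 : g l⁻¹ ≤ (K₂⁻¹) ^ (1 / p) := by
      refine le_trans ?_ hl.le
      rw [Real.rpow_neg hl0.le, ← div_eq_mul_inv, le_div_iff₀ (by positivity)]
      linarith
    have h5 : g l⁻¹ ^ p ≤ K₂⁻¹ := by
      calc g l⁻¹ ^ p ≤ ((K₂⁻¹) ^ (1 / p)) ^ p :=
            Real.rpow_le_rpow (hpos _ (inv_pos.2 hl0)).le h4 hp.le
        _ = _ := by rw [← Real.rpow_mul (by positivity), one_div_mul_cancel hp.ne', Real.rpow_one]
    calc K₂ * g l⁻¹ ^ p ≤ K₂ * K₂⁻¹ := by gcongr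
      _ = 1 := mul_inv_cancel₀ hK₂.ne'
  have hbdd : BddAbove {r : ℝ | 0 < r ∧ ψ r ≤ 1} := by
    have hlim : Filter.Tendsto (fun l : ℝ => (l / 4) ^ δ * g 1) Filter.atTop Filter.atTop :=
      ((tendsto_rpow_atTop hδ).comp
        (Filter.tendsto_id.atTop_div_const (by norm_num))).atTop_mul_const hg1
    obtain ⟨L, hL⟩ := Filter.eventually_atTop.1 (hlim.eventually_gt_atTop (K₁ ^ (1 / p)))
    refine ⟨max L 1, fun r hr => ?_⟩
    by_contra! hlt
    obtain ⟨hrL, hr1⟩ := max_lt_iff.1 hlt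
    have h := growth_of_reverse_doubling hδ hmono hrev hpos one_pos hr1.le
    rw [mul_one] at h
    exact absurd (h.trans (hle r hr.1 hr.2)) (not_le.2 (hL r hrL.le))
  obtain ⟨r₀, hr₀⟩ := hne
  set R := sSup {r : ℝ | 0 < r ∧ ψ r ≤ 1} with hR
  have hR0 : 0 < R := hr₀.1.trans_le (le_csSup hbdd hr₀)
  refine ⟨hR0, ?_, ?_⟩
  -- No continuity of `ψ` is needed: `2R` fails the condition and some `r > R/2` satisfies it, and
  -- doubling carries both facts to `R`.
  · have hnot : 1 < ψ (2 * R) := by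
      by_contra! hle1
      have := le_csSup hbdd (show 2 * R ∈ {r : ℝ | 0 < r ∧ ψ r ≤ 1} from ⟨by positivity, hle1⟩)
      linarith
    have h := hnot.le.trans (h₂ (2 * R) (by positivity))
    have hg2 := hpos (2 * R) (by positivity)
    have h3 : (K₂⁻¹) ^ (1 / p) ≤ g (2 * R) := by
      rw [← Real.rpow_le_rpow_iff (by positivity) hg2.le hp, ← Real.rpow_mul (by positivity),
        one_div_mul_cancel hp.ne', Real.rpow_one, inv_le_iff_one_le_mul₀' hK₂]
      exact h
    rw [inv_mul_le_iff₀ (by positivity)]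
    exact h3.trans (hdbl R hR0)
  · obtain ⟨r, hr, hrR⟩ := exists_lt_of_lt_csSup ⟨r₀, hr₀⟩ (half_lt_self hR0)
    calc g R = g (2 * (R / 2)) := by rw [mul_div_cancel₀ _ two_ne_zero]
      _ ≤ 2 ^ n * g (R / 2) := hdbl _ (by positivity)
      _ ≤ 2 ^ n * g r := by gcongr; exact hmono _ _ (by positivity) hrR.le
      _ ≤ _ := by gcongr; exact hle r hr.1 hr.2

/-- **Shen's estimate**: the critical radius function of a nontrivial potential in the reverse
Hölder class `RH_{d/2}` is positive and admits admissible constants. -/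
theorem ReverseHolder.criticalRadius_pos_and_shenComparison {d : ℕ} (hd : 3 ≤ d)
    {V : EuclideanSpace ℝ (Fin d) → ℝ} (hV : ReverseHolder ((d : ℝ≥0∞) / 2) V)
    (hV0 : ¬ V =ᵐ[volume] (fun _ => 0)) :
    (∀ x, 0 < criticalRadius V x) ∧ ∃ C N : ℝ, ShenComparison (criticalRadius V) C N := by
  obtain ⟨K₁, hK₁, hKM⟩ := hV.eLpNorm_le_scaledMass hd
  obtain ⟨D, hD, hDψ⟩ := hV.exists_scaledMass_two_mul_le hd
  set q : ℝ := (d : ℝ) / 2 with hq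
  have hq0 : 0 < q := by positivity
  set p : ℝ := 1 / q with hp
  have hp0 : 0 < p := by positivity
  set v := volume.real (Metric.ball (0 : EuclideanSpace ℝ (Fin d)) 1) with hv
  have hv0 : 0 < v := ENNReal.toReal_pos (Metric.measure_ball_pos volume _ one_pos).ne'
    measure_ball_lt_top.ne
  set w : Measure (EuclideanSpace ℝ (Fin d)) := volume.withDensity fun x => ‖V x‖ₑ ^ q with hw
  have hLp : ∀ x r, eLpNorm V ((d : ℝ≥0∞) / 2) (volume.restrict (Metric.ball x r)) =
      w (Metric.ball x r) ^ p := by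
    intro x r
    rw [eLpNorm_eq_lintegral_rpow_enorm_toReal
      (zero_lt_one.trans_le (one_le_natCast_div_two hd)).ne' (ENNReal.div_ne_top (by simp) (by simp)),
      toReal_natCast_div_two, hw, withDensity_apply _ Metric.isOpen_ball.measurableSet]
  have hwfin : ∀ x r, w (Metric.ball x r) ≠ ∞ := by
    intro x r
    rcases le_or_gt r 0 with hr | hr
    · simp [Metric.ball_eq_empty.2 hr]
    have := ne_top_of_le_ne_top ENNReal.ofReal_ne_top (hKM x r hr)
    rw [hLp] at this
    exact fun h => this (by rw [h, ENNReal.top_rpow_of_pos hp0])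
  have hLpr : ∀ x r, (eLpNorm V ((d : ℝ≥0∞) / 2) (volume.restrict (Metric.ball x r))).toReal =
      w.real (Metric.ball x r) ^ p := fun x r => by
    rw [hLp, ← ENNReal.toReal_rpow, measureReal_def]
  have h₁ : ∀ x r, 0 < r → w.real (Metric.ball x r) ^ p ≤ K₁ * scaledMass V x r := by
    intro x r hr
    rw [← hLpr]
    have := scaledMass_nonneg hV.nonneg x hr
    exact ENNReal.toReal_le_of_le_ofReal (by positivity) (hKM x r hr)
  set K₂ : ℝ := v ^ (1 - 1 / q) with hK₂
  have hK₂0 : 0 < K₂ := by positivity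
  have h₂ : ∀ x r, 0 < r → scaledMass V x r ≤ K₂ * w.real (Metric.ball x r) ^ p := by
    intro x r hr
    have := setIntegral_le_eLpNorm_mul_rpow (one_le_natCast_div_two hd) hV.nonneg
      (integrableOn_ball_of_locallyIntegrable hV.locallyIntegrable x r) measure_ball_lt_top.ne
      (ne_top_of_le_ne_top ENNReal.ofReal_ne_top (hKM x r hr))
    rw [hLpr, toReal_natCast_div_two, volume_real_ball (by omega) _ hr.le,
      Real.mul_rpow (by positivity) (by positivity), pow_rpow_one_sub hd hr.le] at this
    rw [scaledMass, one_div, inv_mul_le_iff₀ (by positivity)]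
    exact this.trans_eq (by rw [hK₂]; ring)
  have hpos : ∀ x r, 0 < r → 0 < w.real (Metric.ball x r) := by
    intro x r hr
    refine measureReal_nonneg.lt_of_ne fun h => ?_
    have := h₂ x r hr
    rw [← h, Real.zero_rpow hp0.ne', mul_zero] at this
    exact absurd (hV.scaledMass_pos hd hV0 x hr) (not_lt.2 this)
  obtain ⟨n, hn⟩ := pow_unbounded_of_one_lt ((K₁ * D * K₂) ^ (1 / p)) (one_lt_two : (1 : ℝ) < 2)
  have hdbl : ∀ x r, 0 < r →
      w.real (Metric.ball x (2 * r)) ≤ 2 ^ n * w.real (Metric.ball x r) := by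
    intro x r hr
    have hg := hpos x r hr
    refine le_trans ?_ (mul_le_mul_of_nonneg_right hn.le hg.le)
    rw [← Real.rpow_le_rpow_iff measureReal_nonneg (by positivity) hp0,
      Real.mul_rpow (by positivity) hg.le, ← Real.rpow_mul (by positivity),
      one_div_mul_cancel hp0.ne', Real.rpow_one]
    calc _ ≤ K₁ * scaledMass V x (2 * r) := h₁ x _ (by positivity)
      _ ≤ K₁ * (D * (K₂ * w.real (Metric.ball x r) ^ p)) := by
        gcongr
        exact (hDψ x r hr).trans (by gcongr; exact h₂ x r hr)
      _ = _ := by ring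
  -- Chosen so that `4^δ` is the constant of `reverse_doubling_of_doubling` with `D = 2^n`.
  set δ : ℝ := Real.logb 4 (1 + ((2 : ℝ) ^ n * 2 ^ n)⁻¹) with hδ
  have hδ0 : 0 < δ := Real.logb_pos (by norm_num) (by
    have : 0 < ((2 : ℝ) ^ n * 2 ^ n)⁻¹ := by positivity
    linarith)
  have hrev : ∀ x r, 0 < r →
      4 ^ δ * w.real (Metric.ball x r) ≤ w.real (Metric.ball x (4 * r)) := by
    intro x r hr
    rw [hδ, Real.rpow_logb (by norm_num) (by norm_num) (by positivity)]
    exact reverse_doubling_of_doubling (by omega) hwfin (by positivity) hdbl x hr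
  have hmono : ∀ x y r s, 0 < r → r + ‖x - y‖ ≤ s →
      w.real (Metric.ball x r) ≤ w.real (Metric.ball y s) := fun x y r s _ hrs =>
    measureReal_mono (Metric.ball_subset_ball' (by rwa [dist_eq_norm])) (hwfin _ _)
  have hρ := fun x => csSup_bounds_of_growth (g := fun r => w.real (Metric.ball x r)) hδ0 hp0 hK₁
    hK₂0 (fun r s hr hrs => hmono x x r s hr (by simpa using hrs)) (hdbl x) (hrev x) (hpos x)
    (h₁ x) (h₂ x)
  exact ⟨fun x => (hρ x).1, exists_shenComparison_of_doubling
    (F := fun x r => w.real (Metric.ball x r)) hmono hdbl hδ0 hrev hpos (fun x => (hρ x).1)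
    (by positivity : 0 < ((2 : ℝ) ^ n)⁻¹ * (K₂⁻¹) ^ (1 / p)) (fun x => (hρ x).2.1)
    (fun x => (hρ x).2.2)⟩

/-! ### Dyadic stopping cubes and John–Nirenberg in the sup norm -/

section DyadicStopping

variable {ι : Type*} [Fintype ι]

/-- The centre of the dyadic child, with sign pattern `s`, of the sup-norm ball `B(c, R)`. -/
noncomputable def childCenter (c : ι → ℝ) (R : ℝ) (s : ι → Bool) : ι → ℝ :=
  fun i => c i + if s i then R / 2 else -(R / 2)

theorem childCenter_ball_subset {c : ι → ℝ} {R : ℝ} (hR : 0 < R) (s : ι → Bool) :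
    Metric.closedBall (childCenter c R s) (R / 2) ⊆ Metric.closedBall c R := by
  refine Metric.closedBall_subset_closedBall' ?_
  have : dist (childCenter c R s) c ≤ R / 2 := by
    refine (dist_pi_le_iff (by positivity)).2 fun i => ?_
    rw [childCenter, Real.dist_eq, add_sub_cancel_left]
    split_ifs
    · rw [abs_of_pos (by positivity)]
    · rw [abs_neg, abs_of_pos (by positivity)]
  linarith

theorem exists_mem_childCenter_ball {c x : ι → ℝ} {R : ℝ} (hR : 0 < R)
    (hx : x ∈ Metric.closedBall c R) :
    ∃ s : ι → Bool, x ∈ Metric.closedBall (childCenter c R s) (R / 2) := by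
  rw [Metric.mem_closedBall, dist_pi_le_iff hR.le] at hx
  refine ⟨fun i => decide (c i ≤ x i), Metric.mem_closedBall.2
    ((dist_pi_le_iff (by positivity)).2 fun i => ?_)⟩
  have h := hx i
  rw [Real.dist_eq, abs_le] at h
  rw [childCenter, Real.dist_eq, abs_le]
  by_cases hi : c i ≤ x i
  · simp only [hi, decide_true, if_true]
    constructor <;> linarith
  · simp only [hi, decide_false]
    rw [not_le] at hi
    constructor <;> simp only [Bool.false_eq_true, if_false] <;> linarith

/-- Two distinct children differ in some sign `i`, so they meet only in the null hyperplane `x i = c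
i`. -/
theorem aedisjoint_childCenter_ball (c : ι → ℝ) (R : ℝ) :
    Pairwise fun s t : ι → Bool =>
      AEDisjoint volume (Metric.closedBall (childCenter c R s) (R / 2))
        (Metric.closedBall (childCenter c R t) (R / 2)) := by
  intro s t hst
  obtain ⟨i, hi⟩ := Function.ne_iff.1 hst
  refine measure_mono_null (t := {x : ι → ℝ | x i = c i}) ?_ (Measure.pi_hyperplane _ i _)
  rintro x ⟨hs, ht⟩
  rw [Metric.mem_closedBall] at hs ht
  have hs' := (dist_le_pi_dist x _ i).trans hs
  have ht' := (dist_le_pi_dist x _ i).trans ht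
  rw [childCenter, Real.dist_eq, abs_le] at hs' ht'
  rw [Set.mem_ofPred_eq]
  cases hsi : s i <;> cases hti : t i <;> simp only [hsi, hti] at hi hs' ht' <;>
    simp at hi hs' ht' <;> linarith

theorem volume_closedBall_eq_two_pow_mul (c c' : ι → ℝ) {R : ℝ} (hR : 0 < R) :
    volume (Metric.closedBall c R) =
      2 ^ Fintype.card ι * volume (Metric.closedBall c' (R / 2)) := by
  rw [Real.volume_pi_closedBall _ hR.le, Real.volume_pi_closedBall _ (by positivity),
    show (2 : ℝ≥0∞) = ENNReal.ofReal 2 by simp, ← ENNReal.ofReal_pow (by norm_num),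
    ← ENNReal.ofReal_mul (by positivity), ← mul_pow, mul_div_cancel₀ _ two_ne_zero]

theorem sum_lintegral_childCenter_ball_le [DecidableEq ι] (h : (ι → ℝ) → ℝ≥0∞) (c : ι → ℝ)
    {R : ℝ} (hR : 0 < R) :
    ∑ s : ι → Bool, ∫⁻ x in Metric.closedBall (childCenter c R s) (R / 2), h x ≤
      ∫⁻ x in Metric.closedBall c R, h x := by
  rw [← tsum_fintype (L := .unconditional _), ← lintegral_iUnion₀
    (fun s => Metric.isClosed_closedBall.measurableSet.nullMeasurableSet)
    (aedisjoint_childCenter_ball c R)]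
  exact lintegral_mono_set (Set.iUnion_subset fun s => childCenter_ball_subset hR s)

open Classical in
/-- The part of `B(c, R)` covered by the maximal dyadic subcubes, down to depth `n`, on which the
average of `h` exceeds `α`. -/
noncomputable def stopSet (h : (ι → ℝ) → ℝ≥0∞) (α : ℝ≥0∞) : ℕ → (ι → ℝ) → ℝ → Set (ι → ℝ)
  | 0, _, _ => ∅
  | n + 1, c, R => ⋃ s : ι → Bool,
      if α * volume (Metric.closedBall (childCenter c R s) (R / 2)) <
        ∫⁻ x in Metric.closedBall (childCenter c R s) (R / 2), h x
      then Metric.closedBall (childCenter c R s) (R / 2)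
      else stopSet h α n (childCenter c R s) (R / 2)

theorem stopSet_subset_succ (h : (ι → ℝ) → ℝ≥0∞) (α : ℝ≥0∞) (n : ℕ) (c : ι → ℝ) (R : ℝ) :
    stopSet h α n c R ⊆ stopSet h α (n + 1) c R := by
  induction n generalizing c R with
  | zero => simp [stopSet]
  | succ n ih =>
    rw [stopSet, stopSet]
    refine Set.iUnion_mono fun s => ?_
    split_ifs
    · exact subset_rfl
    · exact ih _ _

/-- Sums a local estimate over the stopping cubes by recursion, without enumerating them. `H` is
needed only for a cube whose parent has average at most `α`, which caps the cube's own average at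
`2^d α`. -/
theorem measure_inter_stopSet_le {h : (ι → ℝ) → ℝ≥0∞} {α κ : ℝ≥0∞} {E Q : Set (ι → ℝ)}
    (H : ∀ c R, 0 < R → Metric.closedBall c R ⊆ Q →
      ∫⁻ x in Metric.closedBall c R, h x ≤ α * volume (Metric.closedBall c R) → ∀ s : ι → Bool,
      α * volume (Metric.closedBall (childCenter c R s) (R / 2)) <
        ∫⁻ x in Metric.closedBall (childCenter c R s) (R / 2), h x →
      volume (E ∩ Metric.closedBall (childCenter c R s) (R / 2)) ≤
        κ * ∫⁻ x in Metric.closedBall (childCenter c R s) (R / 2), h x)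
    (n : ℕ) {c : ι → ℝ} {R : ℝ} (hR : 0 < R) (hQ : Metric.closedBall c R ⊆ Q)
    (hgood : ∫⁻ x in Metric.closedBall c R, h x ≤ α * volume (Metric.closedBall c R)) :
    volume (E ∩ stopSet h α n c R) ≤ κ * ∫⁻ x in Metric.closedBall c R, h x := by
  classical
  induction n generalizing c R with
  | zero => simp [stopSet]
  | succ n ih =>
    refine le_trans ?_ (mul_le_mul_right (sum_lintegral_childCenter_ball_le h c hR) κ)
    rw [stopSet, Set.inter_iUnion, Finset.mul_sum]
    refine (measure_iUnion_fintype_le _ _).trans (Finset.sum_le_sum fun s _ => ?_)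
    split_ifs with hs
    · exact H c R hR hQ hgood s hs
    · exact ih (by positivity) ((childCenter_ball_subset hR s).trans hQ) (not_lt.1 hs)

/-- By Lebesgue differentiation, almost every point outside the stopping cubes has small value. -/
theorem ae_mem_iUnion_stopSet {G : (ι → ℝ) → ℝ} (hG : LocallyIntegrable G volume)
    (hG0 : ∀ x, 0 ≤ G x) {a : ℝ} (ha : 0 ≤ a) {c : ι → ℝ} {R : ℝ} (hR : 0 < R)
    (hgood : ∫⁻ x in Metric.closedBall c R, ENNReal.ofReal (G x) ≤
      ENNReal.ofReal a * volume (Metric.closedBall c R)) :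
    ∀ᵐ x, x ∈ Metric.closedBall c R → a < G x →
      x ∈ ⋃ n, stopSet (fun y => ENNReal.ofReal (G y)) (ENNReal.ofReal a) n c R := by
  filter_upwards [IsUnifLocDoublingMeasure.ae_tendsto_average volume hG 1] with x hx hxc hax
  by_contra hnot
  rw [Set.mem_iUnion, not_exists] at hnot
  -- A point missed at every depth lies in a cube of each generation with average at most `a`. These
  -- cubes are not centred at `x`; the parameter 1 in the differentiation theorem only asks that
  -- they contain it.
  have key : ∀ k : ℕ, ∃ w : ι → ℝ, x ∈ Metric.closedBall w (R / 2 ^ k) ∧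
      ∫⁻ x in Metric.closedBall w (R / 2 ^ k), ENNReal.ofReal (G x) ≤
        ENNReal.ofReal a * volume (Metric.closedBall w (R / 2 ^ k)) ∧
      ∀ n, x ∉ stopSet (fun y => ENNReal.ofReal (G y)) (ENNReal.ofReal a) n w (R / 2 ^ k) := by
    intro k
    induction k with
    | zero => exact ⟨c, by simpa using hxc, by simpa using hgood, by simpa using hnot⟩
    | succ k ih =>
      obtain ⟨w, hw, -, hout⟩ := ih
      obtain ⟨s, hs⟩ := exists_mem_childCenter_ball (by positivity : 0 < R / 2 ^ k) hw
      have hdiv : R / 2 ^ (k + 1) = R / 2 ^ k / 2 := by rw [pow_succ, div_div]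
      have hbad : ¬ ENNReal.ofReal a *
          volume (Metric.closedBall (childCenter w (R / 2 ^ k) s) (R / 2 ^ k / 2)) <
          ∫⁻ x in Metric.closedBall (childCenter w (R / 2 ^ k) s) (R / 2 ^ k / 2),
            ENNReal.ofReal (G x) := fun hbad => hout 1 (by
        rw [stopSet]
        exact Set.mem_iUnion.2 ⟨s, by rwa [if_pos hbad]⟩)
      refine ⟨childCenter w (R / 2 ^ k) s, ?_⟩
      rw [hdiv]
      refine ⟨hs, not_lt.1 hbad, fun n hn => hout (n + 1) ?_⟩
      rw [stopSet]
      exact Set.mem_iUnion.2 ⟨s, by rwa [if_neg hbad]⟩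
  choose w hw hwgood _ using key
  have hlim : Filter.Tendsto (fun k : ℕ => R / 2 ^ k) Filter.atTop
      (nhdsWithin 0 (Set.Ioi 0)) := by
    refine tendsto_nhdsWithin_iff.2 ⟨?_, Filter.Eventually.of_forall fun k => ?_⟩
    · exact tendsto_const_nhds.div_atTop (tendsto_pow_atTop_atTop_of_one_lt (by norm_num))
    · exact Set.mem_Ioi.2 (by positivity)
  have hconv := hx w (fun k : ℕ => R / 2 ^ k) hlim
    (Filter.Eventually.of_forall fun k => by simpa using hw k)
  refine absurd (le_of_tendsto hconv (Filter.Eventually.of_forall fun k => ?_)) (not_le.2 hax)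
  have hr : 0 < R / 2 ^ k := by positivity
  have hv0 : 0 < volume.real (Metric.closedBall (w k) (R / 2 ^ k)) :=
    ENNReal.toReal_pos (Metric.measure_closedBall_pos volume _ hr).ne'
      measure_closedBall_lt_top.ne
  rw [setAverage_eq, smul_eq_mul, inv_mul_le_iff₀ hv0,
    integral_eq_lintegral_of_nonneg_ae (Filter.Eventually.of_forall hG0)
      hG.aestronglyMeasurable.restrict, measureReal_def, mul_comm]
  refine (ENNReal.toReal_mono (ENNReal.mul_ne_top ENNReal.ofReal_ne_top
    measure_closedBall_lt_top.ne) (hwgood k)).trans_eq ?_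
  rw [ENNReal.toReal_mul, ENNReal.toReal_ofReal ha]

/-- **John–Nirenberg** for functions of bounded lower oscillation on the subcubes of `Q`. -/
theorem volume_superlevel_le_exp_neg {f : (ι → ℝ) → ℝ} (hf : LocallyIntegrable f volume)
    {m : (ι → ℝ) → ℝ → ℝ} {Q : Set (ι → ℝ)} {A : ℝ} (hA : 0 < A)
    (hm : ∀ c R, 0 < R → Metric.closedBall c R ⊆ Q →
      ∀ᵐ x ∂volume.restrict (Metric.closedBall c R), m c R ≤ f x)
    (hosc : ∀ c R, 0 < R → Metric.closedBall c R ⊆ Q →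
      ∫⁻ x in Metric.closedBall c R, ENNReal.ofReal (f x - m c R) ≤
        ENNReal.ofReal A * volume (Metric.closedBall c R))
    (k : ℕ) {c : ι → ℝ} {R : ℝ} (hR : 0 < R) (hQ : Metric.closedBall c R ⊆ Q) :
    volume {x ∈ Metric.closedBall c R |
        k * (2 ^ Fintype.card ι * Real.exp 1 * A) < f x - m c R} ≤
      ENNReal.ofReal (Real.exp (-k)) * volume (Metric.closedBall c R) := by
  induction k generalizing c R with
  | zero =>
    simp only [Nat.cast_zero, neg_zero, Real.exp_zero, ENNReal.ofReal_one, one_mul]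
    exact measure_mono (Set.sep_subset _ _)
  | succ k ih =>
    set T : ℝ := 2 ^ Fintype.card ι * Real.exp 1 * A with hT
    have hT0 : 0 < T := by positivity
    set a : ℝ := Real.exp 1 * A with ha
    have ha0 : 0 < a := by positivity
    have hAa : A ≤ a := le_mul_of_one_le_left hA.le (Real.one_le_exp zero_le_one)
    have haT : a ≤ T := by
      rw [hT, mul_assoc]
      exact le_mul_of_one_le_left ha0.le (one_le_pow₀ (by norm_num))
    -- The lower bound `m c R ≤ f` holds only almost everywhere on the cube; the positive part is
    -- nonnegative everywhere and has the same `ENNReal.ofReal`.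
    set G : (ι → ℝ) → ℝ := fun x => max (f x - m c R) 0 with hG
    have hGf : ∀ x, ENNReal.ofReal (G x) = ENNReal.ofReal (f x - m c R) := fun x => by
      rw [hG, ENNReal.ofReal_max, ENNReal.ofReal_zero, max_eq_left zero_le]
    have hGint : LocallyIntegrable G volume := by
      have h1 : LocallyIntegrable (fun x => f x - m c R) volume :=
        hf.sub (locallyIntegrable_const _)
      exact h1.mono (h1.aestronglyMeasurable.sup aestronglyMeasurable_const)
        (Filter.Eventually.of_forall fun x => by
          rw [Real.norm_eq_abs, Real.norm_eq_abs, abs_of_nonneg (le_max_right _ _)]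
          exact max_le (le_abs_self _) (abs_nonneg _))
    have hosc' := hosc c R hR hQ
    simp only [← hGf] at hosc'
    have hgood : ∫⁻ x in Metric.closedBall c R, ENNReal.ofReal (G x) ≤
        ENNReal.ofReal a * volume (Metric.closedBall c R) :=
      hosc'.trans (by gcongr)
    set E := {x ∈ Metric.closedBall c R | ((k + 1 : ℕ) : ℝ) * T < f x - m c R} with hE
    set S := stopSet (fun y => ENNReal.ofReal (G y)) (ENNReal.ofReal a) with hS
    set κ : ℝ≥0∞ := ENNReal.ofReal (Real.exp (-k)) / ENNReal.ofReal a with hκ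
    have ha' : ENNReal.ofReal a ≠ 0 := (ENNReal.ofReal_pos.2 ha0).ne'
    have hout : ∀ n, volume (E ∩ S n c R) ≤
        κ * ∫⁻ x in Metric.closedBall c R, ENNReal.ofReal (G x) := by
      intro n
      refine measure_inter_stopSet_le (Q := Metric.closedBall c R) ?_ n hR subset_rfl hgood
      intro b r hr hbr hb s hbad
      have hsub := childCenter_ball_subset (c := b) hr s
      have hr2 : 0 < r / 2 := by positivity
      set z := childCenter b r s with hz
      have hv0 : volume (Metric.closedBall z (r / 2)) ≠ 0 :=
        (Metric.measure_closedBall_pos volume z hr2).ne'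
      have hv : volume (Metric.closedBall z (r / 2)) ≠ ∞ := measure_closedBall_lt_top.ne
      have hzQ : Metric.closedBall z (r / 2) ⊆ Q := (hsub.trans hbr).trans hQ
      -- Average `m z ≤ f` over the stopped cube: the parent's average is at most `a`, and passing
      -- to a child costs `2^d`. This is what lets `ih` be applied at height `kT`.
      have hmz : m z (r / 2) - m c R ≤ T := by
        rw [← ENNReal.ofReal_le_ofReal_iff hT0.le, ← ENNReal.mul_le_mul_iff_left hv0 hv]
        calc ENNReal.ofReal (m z (r / 2) - m c R) * volume (Metric.closedBall z (r / 2))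
            = ∫⁻ _ in Metric.closedBall z (r / 2), ENNReal.ofReal (m z (r / 2) - m c R) := by
              rw [setLIntegral_const]
          _ ≤ ∫⁻ x in Metric.closedBall z (r / 2), ENNReal.ofReal (G x) := by
              refine lintegral_mono_ae ?_
              filter_upwards [hm z _ hr2 hzQ] with x hx
              rw [hGf]
              gcongr
          _ ≤ ∫⁻ x in Metric.closedBall b r, ENNReal.ofReal (G x) := lintegral_mono_set hsub
          _ ≤ ENNReal.ofReal a * volume (Metric.closedBall b r) := hb
          _ = ENNReal.ofReal T * volume (Metric.closedBall z (r / 2)) := by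
              rw [volume_closedBall_eq_two_pow_mul b z hr, ← mul_assoc,
                show T = a * 2 ^ Fintype.card ι by rw [hT, ha]; ring, ENNReal.ofReal_mul ha0.le,
                ENNReal.ofReal_pow (by norm_num), ENNReal.ofReal_ofNat]
      calc volume (E ∩ Metric.closedBall z (r / 2))
          ≤ volume {x ∈ Metric.closedBall z (r / 2) | k * T < f x - m z (r / 2)} := by
            refine measure_mono fun x hx => ⟨hx.2, ?_⟩
            have h1 := hx.1.2
            push_cast at h1
            linarith
        _ ≤ ENNReal.ofReal (Real.exp (-k)) * volume (Metric.closedBall z (r / 2)) := ih hr2 hzQ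
        _ = κ * (ENNReal.ofReal a * volume (Metric.closedBall z (r / 2))) := by
            rw [← mul_assoc, hκ, ENNReal.div_mul_cancel ha' ENNReal.ofReal_ne_top]
        _ ≤ _ := by gcongr
    have hEcover : E ≤ᵐ[volume] ⋃ n, E ∩ S n c R := by
      filter_upwards [ae_mem_iUnion_stopSet hGint (fun x => le_max_right _ _) ha0.le hR hgood]
        with x hx hxE
      rw [← Set.inter_iUnion]
      refine ⟨hxE, hx hxE.1 ?_⟩
      have h1 := hxE.2
      push_cast at h1
      have h2 : 0 ≤ (k : ℝ) * T := by positivity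
      exact lt_max_of_lt_left (by linarith)
    have hmono : Monotone fun n => E ∩ S n c R :=
      monotone_nat_of_le_succ fun n => Set.inter_subset_inter_right _ (stopSet_subset_succ _ _ n c R)
    calc volume E ≤ volume (⋃ n, E ∩ S n c R) := measure_mono_ae hEcover
      _ = ⨆ n, volume (E ∩ S n c R) := hmono.measure_iUnion
      _ ≤ κ * ∫⁻ x in Metric.closedBall c R, ENNReal.ofReal (G x) := iSup_le hout
      _ ≤ κ * (ENNReal.ofReal A * volume (Metric.closedBall c R)) := by gcongr
      _ = _ := by
        -- The ratio `A / a = 1/e` supplies the gain of this generation.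
        rw [← mul_assoc, hκ, ← ENNReal.ofReal_div_of_pos ha0, ← ENNReal.ofReal_mul (by positivity)]
        congr 2
        rw [ha]
        push_cast
        rw [neg_add, Real.exp_add, Real.exp_neg 1]
        field_simp

end DyadicStopping

/-! ### Transfer to Euclidean cubes -/

section

variable {d : ℕ}

/-- Lets the sup-norm result be used: the identification with `Fin d → ℝ` preserves volume and turns
side `r` into radius `r/2`. -/
theorem toLp_preimage_cube (x : EuclideanSpace ℝ (Fin d)) {r : ℝ} (hr : 0 ≤ r) :
    WithLp.toLp 2 ⁻¹' cube x r = Metric.closedBall (WithLp.ofLp x) (r / 2) := by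
  ext y
  rw [Metric.mem_closedBall, dist_pi_le_iff (by positivity)]
  simp only [Real.dist_eq]
  rfl

theorem measurableEmbedding_toLp :
    MeasurableEmbedding (WithLp.toLp 2 : (Fin d → ℝ) → EuclideanSpace ℝ (Fin d)) :=
  (MeasurableEquiv.toLp 2 (Fin d → ℝ)).measurableEmbedding

theorem volume_cube (x : EuclideanSpace ℝ (Fin d)) {r : ℝ} (hr : 0 < r) :
    volume (cube x r) = ENNReal.ofReal (r ^ d) := by
  rw [← (PiLp.volume_preserving_toLp (Fin d)).measure_preimage_emb measurableEmbedding_toLp,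
    toLp_preimage_cube x hr.le, Real.volume_pi_closedBall _ (by positivity), Fintype.card_fin,
    mul_div_cancel₀ _ two_ne_zero]

theorem volume_cube_ne_zero (x : EuclideanSpace ℝ (Fin d)) {r : ℝ} (hr : 0 < r) :
    volume (cube x r) ≠ 0 := by
  rw [volume_cube x hr]
  exact (ENNReal.ofReal_pos.2 (by positivity)).ne'

theorem volume_cube_ne_top (x : EuclideanSpace ℝ (Fin d)) {r : ℝ} (hr : 0 < r) :
    volume (cube x r) ≠ ∞ := by
  rw [volume_cube x hr]
  exact ENNReal.ofReal_ne_top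

/-- **John–Nirenberg** for functions of bounded lower oscillation on the subcubes of a cube. -/
theorem volume_cube_superlevel_le_exp_neg {f : EuclideanSpace ℝ (Fin d) → ℝ}
    (hf : LocallyIntegrable f volume) {m : EuclideanSpace ℝ (Fin d) → ℝ → ℝ} {A : ℝ} (hA : 0 < A)
    {x₀ : EuclideanSpace ℝ (Fin d)} {r₀ : ℝ} (hr₀ : 0 < r₀)
    (hm : ∀ x r, 0 < r → cube x r ⊆ cube x₀ r₀ → ∀ᵐ y ∂volume.restrict (cube x r), m x r ≤ f y)
    (hosc : ∀ x r, 0 < r → cube x r ⊆ cube x₀ r₀ →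
      ∫⁻ y in cube x r, ENNReal.ofReal (f y - m x r) ≤ ENNReal.ofReal A * volume (cube x r))
    (k : ℕ) :
    volume {y ∈ cube x₀ r₀ | k * (2 ^ d * Real.exp 1 * A) < f y - m x₀ r₀} ≤
      ENNReal.ofReal (Real.exp (-k)) * volume (cube x₀ r₀) := by
  have hmp := PiLp.volume_preserving_toLp (Fin d)
  have hemb := measurableEmbedding_toLp (d := d)
  have hpre : ∀ (c : Fin d → ℝ) (R : ℝ), 0 < R →
      WithLp.toLp 2 ⁻¹' cube (WithLp.toLp 2 c) (2 * R) = Metric.closedBall c R := by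
    intro c R hR
    rw [toLp_preimage_cube _ (by positivity), mul_div_cancel_left₀ _ two_ne_zero]
  have hsub : ∀ (c : Fin d → ℝ) (R : ℝ), 0 < R →
      Metric.closedBall c R ⊆ WithLp.toLp 2 ⁻¹' cube x₀ r₀ →
      cube (WithLp.toLp 2 c) (2 * R) ⊆ cube x₀ r₀ := by
    intro c R hR h
    rw [← hpre c R hR] at h
    exact (Set.preimage_subset_preimage_iff
      (by rw [(WithLp.toLp_surjective 2).range_eq]; exact Set.subset_univ _)).1 h
  have hf' : LocallyIntegrable (f ∘ WithLp.toLp 2) (volume : Measure (Fin d → ℝ)) := by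
    have h := (locallyIntegrable_map_homeomorph
      (PiLp.homeomorph 2 fun _ : Fin d => ℝ).symm (f := f) (μ := volume)).1
    refine h ?_
    have : Measure.map (PiLp.homeomorph 2 fun _ : Fin d => ℝ).symm volume = volume := hmp.map_eq
    rwa [this]
  have main := volume_superlevel_le_exp_neg hf' (m := fun c R => m (WithLp.toLp 2 c) (2 * R))
    (Q := WithLp.toLp 2 ⁻¹' cube x₀ r₀) hA
    (fun c R hR hQ => by
      have h := hm _ _ (by positivity) (hsub c R hR hQ)
      have h' := (hmp.restrict_preimage_emb hemb
        (cube (WithLp.toLp 2 c) (2 * R))).quasiMeasurePreserving.ae h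
      rwa [hpre c R hR] at h')
    (fun c R hR hQ => by
      have h := hosc _ _ (by positivity) (hsub c R hR hQ)
      rwa [← hmp.setLIntegral_comp_preimage_emb hemb, ← hmp.measure_preimage_emb hemb,
        hpre c R hR] at h)
    k (c := WithLp.ofLp x₀) (R := r₀ / 2) (by positivity) (toLp_preimage_cube x₀ hr₀.le).ge
  rw [Fintype.card_fin, ← toLp_preimage_cube x₀ hr₀.le] at main
  simp only [WithLp.toLp_ofLp, mul_div_cancel₀ r₀ (two_ne_zero (α := ℝ))] at main
  rw [hmp.measure_preimage_emb hemb] at main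
  rw [← hmp.measure_preimage_emb hemb]
  exact main

/-! ### The BLO norm, its localization to subcubes, and the conclusion -/

theorem ae_essInfOn_le (f : EuclideanSpace ℝ (Fin d) → ℝ) (E : Set (EuclideanSpace ℝ (Fin d))) :
    ∀ᵐ y ∂volume.restrict E, essInfOn f E ≤ (f y : EReal) :=
  ae_essInf_le

theorem essInfOn_ne_top (f : EuclideanSpace ℝ (Fin d) → ℝ) (x : EuclideanSpace ℝ (Fin d)) {r : ℝ}
    (hr : 0 < r) : essInfOn f (cube x r) ≠ ⊤ := by
  intro h
  have hne : volume.restrict (cube x r) ≠ 0 := by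
    rw [Ne, Measure.restrict_eq_zero]
    exact volume_cube_ne_zero x hr
  have : (ae (volume.restrict (cube x r))).NeBot := ae_neBot.2 hne
  obtain ⟨y, hy⟩ := (ae_essInfOn_le f (cube x r)).exists
  rw [h, top_le_iff] at hy
  exact EReal.coe_ne_top _ hy

theorem lintegral_cube_le_bloNorm {ρ : EuclideanSpace ℝ (Fin d) → ℝ} (hρ : ∀ x, 0 < ρ x) (θ : ℝ)
    (f : EuclideanSpace ℝ (Fin d) → ℝ) (x : EuclideanSpace ℝ (Fin d)) {r : ℝ} (hr : 0 < r) :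
    ∫⁻ y in cube x r, ((f y : EReal) - essInfOn f (cube x r)).toENNReal ≤
      ENNReal.ofReal ((1 + r / ρ x) ^ θ) * bloNorm ρ θ f * volume (cube x r) := by
  have h : ENNReal.ofReal ((1 + r / ρ x) ^ (-θ)) * ((volume (cube x r))⁻¹ *
      ∫⁻ y in cube x r, ((f y : EReal) - essInfOn f (cube x r)).toENNReal) ≤ bloNorm ρ θ f :=
    le_iSup_of_le x (le_iSup_of_le r (le_iSup_of_le hr le_rfl))
  have hpos : 0 < 1 + r / ρ x := by
    have := hρ x
    positivity
  rw [Real.rpow_neg hpos.le, ENNReal.ofReal_inv_of_pos (by positivity), ENNReal.inv_mul_le_iff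
      (ENNReal.ofReal_pos.2 (by positivity)).ne' ENNReal.ofReal_ne_top, ENNReal.inv_mul_le_iff
      (volume_cube_ne_zero x hr) (volume_cube_ne_top x hr), mul_comm] at h
  exact h

/-- Otherwise the integrand is `⊤` on a set of positive measure, against the finite norm. -/
theorem MemBLO.essInfOn_ne_bot {ρ : EuclideanSpace ℝ (Fin d) → ℝ} (hρ : ∀ x, 0 < ρ x) {θ : ℝ}
    {f : EuclideanSpace ℝ (Fin d) → ℝ} (hf : MemBLO ρ θ f) (x : EuclideanSpace ℝ (Fin d)) {r : ℝ}
    (hr : 0 < r) : essInfOn f (cube x r) ≠ ⊥ := by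
  intro h
  have h1 := lintegral_cube_le_bloNorm hρ θ f x hr
  simp only [h, EReal.sub_bot (EReal.coe_ne_bot _), EReal.toENNReal_top, setLIntegral_const,
    ENNReal.top_mul (volume_cube_ne_zero x hr), top_le_iff] at h1
  exact ENNReal.mul_ne_top (ENNReal.mul_ne_top ENNReal.ofReal_ne_top hf.bloNorm_lt_top.ne)
    (volume_cube_ne_top x hr) h1

theorem norm_sub_le_of_mem_cube {x x₀ : EuclideanSpace ℝ (Fin d)} {r : ℝ} (hr : 0 ≤ r)
    (hx : x ∈ cube x₀ r) : ‖x₀ - x‖ ≤ √(d : ℝ) / 2 * r := by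
  rw [norm_sub_rev, EuclideanSpace.norm_eq]
  calc √(∑ i, ‖(x - x₀) i‖ ^ 2) ≤ √(∑ _i : Fin d, (r / 2) ^ 2) := by
        refine Real.sqrt_le_sqrt (Finset.sum_le_sum fun i _ => ?_)
        gcongr
        simpa using hx i
    _ = _ := by
        rw [Finset.sum_const, Finset.card_univ, Fintype.card_fin, nsmul_eq_mul,
          Real.sqrt_mul (by positivity), Real.sqrt_sq (by positivity)]
        ring

theorem side_le_of_cube_subset (hd : 0 < d) {x x₀ : EuclideanSpace ℝ (Fin d)} {r r₀ : ℝ}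
    (hr : 0 ≤ r) (h : cube x r ⊆ cube x₀ r₀) : r ≤ r₀ := by
  have hc : ∀ σ : ℝ, |σ| ≤ r / 2 → |x ⟨0, hd⟩ + σ - x₀ ⟨0, hd⟩| ≤ r₀ / 2 := by
    intro σ hσ
    have hmem : x + WithLp.toLp 2 (fun _ => σ) ∈ cube x r := fun i => by simpa using hσ
    simpa using h hmem ⟨0, hd⟩
  have h1 := (abs_le.1 (hc (r / 2) (abs_of_nonneg (by positivity)).le)).2
  have h2 := (abs_le.1 (hc (-(r / 2)) (by rw [abs_neg, abs_of_nonneg (by positivity)]))).1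
  linarith

theorem mem_cube_self (x : EuclideanSpace ℝ (Fin d)) {r : ℝ} (hr : 0 ≤ r) : x ∈ cube x r :=
  fun i => by simpa using by positivity

/-- The admissible constants may be enlarged. -/
theorem ShenComparison.mono {ρ : EuclideanSpace ℝ (Fin d) → ℝ} (hρ : ∀ x, 0 < ρ x) {C C₀ N : ℝ}
    (h : ShenComparison ρ C N) (hC : C ≤ C₀) : ShenComparison ρ C₀ N := by
  have h1 := h.one_le
  refine ⟨h1.trans hC, h.pos, fun x y => le_trans ?_ (h.lower x y),
    fun x y => (h.upper x y).trans ?_⟩ <;>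
  · have := hρ x
    gcongr

/-- The relative size of the subcubes of a cube is controlled by that of the cube. -/
theorem ShenComparison.one_add_div_le (hd : 0 < d) {ρ : EuclideanSpace ℝ (Fin d) → ℝ}
    (hρ : ∀ x, 0 < ρ x) {C C₀ N : ℝ} (h : ShenComparison ρ C N)
    (hC : C * (max 1 (√(d : ℝ) / 2)) ^ N ≤ C₀) {x x₀ : EuclideanSpace ℝ (Fin d)} {r r₀ : ℝ}
    (hr : 0 < r) (hsub : cube x r ⊆ cube x₀ r₀) :
    1 + r / ρ x ≤ C₀ * (1 + r₀ / ρ x₀) ^ (N + 1) := by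
  have hrr : r ≤ r₀ := side_le_of_cube_subset hd hr.le hsub
  have hr₀ : 0 < r₀ := hr.trans_le hrr
  have hx := hρ x
  have hx₀ := hρ x₀
  have hC1 := h.one_le
  have hN := h.pos
  set M : ℝ := max 1 (√(d : ℝ) / 2) with hM
  have hM1 : 1 ≤ M := le_max_left _ _
  have hCC : C ≤ C₀ :=
    (le_mul_of_one_le_right (by linarith) (Real.one_le_rpow hM1 hN.le)).trans hC
  set u : ℝ := r₀ / ρ x₀ with hu
  have hu0 : 0 < u := by positivity
  -- The half-diagonal `√d/2 · r₀` bounds the distance of the centres, and `M ≥ 1` absorbs the 1.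
  -- The resulting `M^N` is the factor built into `C₀`.
  have hnorm : 1 + ‖x₀ - x‖ / ρ x₀ ≤ M * (1 + u) := by
    have h1 : ‖x₀ - x‖ ≤ M * r₀ :=
      (norm_sub_le_of_mem_cube hr₀.le (hsub (mem_cube_self x hr.le))).trans
        (by gcongr; exact le_max_right _ _)
    have h2 : ‖x₀ - x‖ / ρ x₀ ≤ M * u := by
      rw [hu, ← mul_div_assoc]
      gcongr
    linarith
  have hlow : ρ x₀ ≤ ρ x * (C₀ * (1 + u) ^ N) := by
    have h3 := h.lower x₀ x
    rw [Real.rpow_neg (by positivity), ← one_div, div_mul_div_comm, one_mul,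
      div_le_div_iff₀ (by positivity) hx₀, one_mul] at h3
    calc ρ x₀ ≤ ρ x * (C * (1 + ‖x₀ - x‖ / ρ x₀) ^ N) := h3
      _ ≤ ρ x * (C * (M * (1 + u)) ^ N) := by gcongr
      _ = ρ x * (C * M ^ N * (1 + u) ^ N) := by
        rw [Real.mul_rpow (by positivity) (by positivity)]; ring
      _ ≤ _ := by gcongr
  have hdiv : r / ρ x ≤ C₀ * (1 + u) ^ N * u := by
    rw [div_le_iff₀ hx]
    calc r ≤ ρ x₀ * u := by rw [hu, mul_div_cancel₀ _ hx₀.ne']; exact hrr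
      _ ≤ ρ x * (C₀ * (1 + u) ^ N) * u := by gcongr
      _ = _ := by ring
  -- With `X = C₀ (1+u)^N ≥ 1`, the sum `1 + Xu` is at most `X(1+u)`; this is how the exponent
  -- becomes `N + 1`.
  have hone : 1 ≤ C₀ * (1 + u) ^ N :=
    one_le_mul_of_one_le_of_one_le (hC1.trans hCC) (Real.one_le_rpow (by linarith) hN.le)
  calc 1 + r / ρ x ≤ C₀ * (1 + u) ^ N * (1 + u) := by linarith
    _ = _ := by rw [Real.rpow_add (by positivity), Real.rpow_one]; ring

/-- **John–Nirenberg inequality** for `BLO_{ρ,θ}` in terms of admissible constants for `ρ`. -/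
theorem MemBLO.volume_superlevel_le (hd : 0 < d) {ρ : EuclideanSpace ℝ (Fin d) → ℝ}
    (hρ : ∀ x, 0 < ρ x) {C C₀ N : ℝ} (h : ShenComparison ρ C N)
    (hC : C * (max 1 (√(d : ℝ) / 2)) ^ N ≤ C₀) {θ : ℝ} (hθ : 0 < θ)
    {f : EuclideanSpace ℝ (Fin d) → ℝ} (hf : MemBLO ρ θ f) (x₀ : EuclideanSpace ℝ (Fin d)) {r : ℝ}
    (hr : 0 < r) {t : ℝ} (ht : 0 < t) :
    volume {x ∈ cube x₀ r | (t : EReal) < (f x : EReal) - essInfOn f (cube x₀ r)} ≤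
      ENNReal.ofReal (Real.exp 1) * volume (cube x₀ r) *
        EReal.exp (-((ENNReal.ofReal ((1 + r / ρ x₀) ^ (-((N + 1) * θ)) *
          (1 / (C₀ ^ θ * 2 ^ d * Real.exp 1) * t)) / bloNorm ρ θ f : ℝ≥0∞) : EReal)) := by
  set m : EuclideanSpace ℝ (Fin d) → ℝ → ℝ := fun x r => (essInfOn f (cube x r)).toReal with hm
  have hmE : ∀ x r, 0 < r → essInfOn f (cube x r) = (m x r : EReal) := fun x r hr =>
    (EReal.coe_toReal (essInfOn_ne_top f x hr) (hf.essInfOn_ne_bot hρ x hr)).symm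
  have hmf : ∀ x r, 0 < r → ∀ᵐ y ∂volume.restrict (cube x r), m x r ≤ f y := by
    intro x r hr
    filter_upwards [ae_essInfOn_le f (cube x r)] with y hy
    rwa [hmE x r hr, EReal.coe_le_coe_iff] at hy
  have hint : ∀ x r, 0 < r → ∫⁻ y in cube x r, ENNReal.ofReal (f y - m x r) ≤
      ENNReal.ofReal ((1 + r / ρ x) ^ θ) * bloNorm ρ θ f * volume (cube x r) := by
    intro x r hr
    have := lintegral_cube_le_bloNorm hρ θ f x hr
    simpa only [hmE x r hr, ← EReal.coe_sub, EReal.real_coe_toENNReal] using this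
  have hset : {x ∈ cube x₀ r | (t : EReal) < (f x : EReal) - essInfOn f (cube x₀ r)} =
      {x ∈ cube x₀ r | t < f x - m x₀ r} := by
    simp only [hmE x₀ r hr, ← EReal.coe_sub, EReal.coe_lt_coe_iff]
  rw [hset]
  -- For zero norm the quotient is `∞` and the right side is 0, so the superlevel set has to be
  -- null.
  rcases eq_or_ne (bloNorm ρ θ f) 0 with h0 | h0
  · have hz := hint x₀ r hr
    rw [h0, mul_zero, zero_mul, nonpos_iff_eq_zero, lintegral_eq_zero_iff'
      ((hf.locallyIntegrable.aestronglyMeasurable.aemeasurable.sub_const _).ennreal_ofReal.restrict)]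
      at hz
    have hnull : volume {x ∈ cube x₀ r | t < f x - m x₀ r} = 0 := by
      have h1 : ∀ᵐ x ∂volume.restrict (cube x₀ r), ¬ t < f x - m x₀ r := by
        filter_upwards [hz] with x hx hlt
        exact (ENNReal.ofReal_pos.2 (ht.trans hlt)).ne' hx
      have hcm : MeasurableSet (cube x₀ r) := by
        have : cube x₀ r = ⋂ i, {x | |x i - x₀ i| ≤ r / 2} := by
          ext x; simp [cube]
        rw [this]
        exact MeasurableSet.iInter fun i => measurableSet_le (by fun_prop) measurable_const
      rw [ae_restrict_iff' hcm, ae_iff] at h1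
      simpa only [Classical.not_imp, not_not] using h1
    rw [hnull]
    exact zero_le
  have hNtop := hf.bloNorm_lt_top.ne
  set B : ℝ := (bloNorm ρ θ f).toReal with hB
  have hB0 : 0 < B := ENNReal.toReal_pos h0 hNtop
  have hBN : bloNorm ρ θ f = ENNReal.ofReal B := (ENNReal.ofReal_toReal hNtop).symm
  have hx₀ := hρ x₀
  have hN := h.pos
  have hC₀ : 0 < C₀ := by
    have := h.one_le
    exact lt_of_lt_of_le (by positivity) hC
  set P : ℝ := (1 + r / ρ x₀) ^ ((N + 1) * θ) with hP
  have hP0 : 0 < P := by positivity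
  set A : ℝ := C₀ ^ θ * P * B with hA
  have hA0 : 0 < A := by positivity
  set T : ℝ := 2 ^ d * Real.exp 1 * A with hT
  have hT0 : 0 < T := by positivity
  have key := volume_cube_superlevel_le_exp_neg hf.locallyIntegrable (m := m) hA0 hr
    (fun x s hs _ => hmf x s hs) (fun x s hs hsub => (hint x s hs).trans (by
      have hx := hρ x
      rw [hBN, ← ENNReal.ofReal_mul (by positivity), hA]
      gcongr
      calc (1 + s / ρ x) ^ θ ≤ (C₀ * (1 + r / ρ x₀) ^ (N + 1)) ^ θ := by
            refine Real.rpow_le_rpow (by positivity) ?_ hθ.le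
            exact h.one_add_div_le hd hρ hC hs hsub
        _ = _ := by rw [Real.mul_rpow hC₀.le (by positivity), hP, Real.rpow_mul (by positivity)]))
    ⌊t / T⌋₊
  have hexp : EReal.exp (-((ENNReal.ofReal ((1 + r / ρ x₀) ^ (-((N + 1) * θ)) *
      (1 / (C₀ ^ θ * 2 ^ d * Real.exp 1) * t)) / bloNorm ρ θ f : ℝ≥0∞) : EReal)) =
      ENNReal.ofReal (Real.exp (-(t / T))) := by
    rw [hBN, ← ENNReal.ofReal_div_of_pos hB0, EReal.coe_ennreal_ofReal, max_eq_left (by positivity),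
      ← EReal.coe_neg, EReal.exp_coe, Real.rpow_neg (by positivity), ← hP, hT, hA]
    congr 3
    field_simp
  rw [hexp]
  -- Rounding `t/T` down to an integer number of generations costs at most one, hence the factor
  -- `e`.
  calc volume {x ∈ cube x₀ r | t < f x - m x₀ r}
      ≤ volume {x ∈ cube x₀ r | ⌊t / T⌋₊ * T < f x - m x₀ r} := by
        refine measure_mono fun x hx => ⟨hx.1, lt_of_le_of_lt ?_ hx.2⟩
        rw [← le_div_iff₀ hT0]
        exact Nat.floor_le (by positivity)
    _ ≤ ENNReal.ofReal (Real.exp (-⌊t / T⌋₊)) * volume (cube x₀ r) := key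
    _ ≤ ENNReal.ofReal (Real.exp 1 * Real.exp (-(t / T))) * volume (cube x₀ r) := by
        gcongr
        rw [← Real.exp_add]
        gcongr
        have := Nat.lt_floor_add_one (t / T)
        linarith
    _ = _ := by rw [ENNReal.ofReal_mul (by positivity)]; ring

end

theorem mainTheorem1 {d : ℕ} (hd : 3 ≤ d) {s : ℝ≥0∞} (hs : (d : ℝ≥0∞) / 2 ≤ s)
    {V : EuclideanSpace ℝ (Fin d) → ℝ} (hV : ReverseHolder s V)
    (hV0 : ¬ V =ᵐ[volume] (fun _ => 0)) :
    (∃ C N : ℝ, ShenComparison (criticalRadius V) C N) ∧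
    ∀ C N₀ : ℝ, ShenComparison (criticalRadius V) C N₀ →
    ∀ C₀ : ℝ, C * (max 1 (√(d : ℝ) / 2)) ^ N₀ ≤ C₀ →
      ShenComparison (criticalRadius V) C₀ N₀ ∧
      ∀ θ : ℝ, 0 < θ → ∀ f : EuclideanSpace ℝ (Fin d) → ℝ, MemBLO (criticalRadius V) θ f →
      ∀ (x₀ : EuclideanSpace ℝ (Fin d)) (r : ℝ), 0 < r → ∀ t : ℝ, 0 < t →
        volume {x ∈ cube x₀ r | (t : EReal) < (f x : EReal) - essInfOn f (cube x₀ r)} ≤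
          ENNReal.ofReal (Real.exp 1) * volume (cube x₀ r) *
            EReal.exp (-((ENNReal.ofReal ((1 + r / criticalRadius V x₀) ^ (-((N₀ + 1) * θ)) *
              (1 / (C₀ ^ θ * 2 ^ d * Real.exp 1) * t)) /
                bloNorm (criticalRadius V) θ f : ℝ≥0∞) : EReal)) := by
  obtain ⟨hρ, hex⟩ := (hV.mono_exponent hs).criticalRadius_pos_and_shenComparison hd hV0
  refine ⟨hex, fun C N₀ h C₀ hC => ⟨h.mono hρ (le_trans ?_ hC), fun θ hθ f hf x₀ r hr t ht =>
    hf.volume_superlevel_le (by omega) hρ h hC hθ x₀ hr ht⟩⟩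
  exact le_mul_of_one_le_right (zero_le_one.trans h.one_le)
    (Real.one_le_rpow (le_max_left _ _) h.pos.le)
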